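/- Let $\mathcal R$ denote Riemann's auxiliary function, the entire function $$\mathcal R(s)=\int_{0\swarrow 1}\frac{x^{-s}e^{\pi i x^2}}{e^{\pi i x}-e^{-\pi i x}}\,dx ,$$ where the path is the straight line through $\tfrac12$ with direction $e^{-3\pi i/4}$, which crosses the real axis between $0$ and $1$ and is traversed from the upper right to the lower left, and $x^{-s}$ is the principal branch. Write $\rho=\beta+i\gamma$ for the zeros of $\mathcal R$, counted with multiplicity. Let $t_0\ge 1$ and $\sigma\le 1$ be fixed. Then the function $t\mapsto\log|\mathcal R(\sigma+it)|$ is integrable on every interval $[t_0,T]$, for every real $T$ there are only finitely many zeros with $\beta>\sigma$ and $0<\gamma\le T$, and, as $T\to+\infty$, $$\int_{t_0}^T\log|\mathcal R(\sigma+it)|\,dt=2\pi\sum_{\substack{\beta>\sigma\\ 0<\gamma\le T}}(\beta-\sigma)+O_\sigma(\log T).$$ Here $O_\sigma$ means that there is a constant $C$ depending only on $\sigma$ such that the error is at most $C\log T$ in absolute value for all $T\ge T_0$, where $T_0$ may depend on $\sigma$ and $t_0$. -/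

import Mathlib

open Complex in
/-- The straight line through `1/2` with direction `e^{-3πi/4}`: it crosses the real axis between
`0` and `1` and is traversed from the upper right to the lower left. -/
noncomputable def swLine (u : ℝ) : ℂ :=
  1 / 2 + (u : ℂ) * exp (-(3 * (Real.pi : ℂ) / 4) * I)

open Complex in
/-- Riemann's auxiliary function
`𝓡(s) = ∫_{0↙1} x^{-s} e^{πi x²} / (e^{πi x} - e^{-πi x}) dx`,
with the principal branch of `x^{-s}` (the line does not meet `(-∞, 0]`). The constant factor is the
derivative of the parametrization `swLine`. -/
noncomputable def riemannAux (s : ℂ) : ℂ :=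
  ∫ u : ℝ, (swLine u) ^ (-s) * exp ((Real.pi : ℂ) * I * (swLine u) ^ 2) /
      (exp ((Real.pi : ℂ) * I * swLine u) - exp (-((Real.pi : ℂ) * I * swLine u))) *
    exp (-(3 * (Real.pi : ℂ) / 4) * I)

/-- The zeros `ρ = β + iγ` of `𝓡` with `β > σ` and `0 < γ ≤ T`. -/
def riemannAuxZeros (σ T : ℝ) : Set ℂ :=
  {ρ : ℂ | riemannAux ρ = 0 ∧ σ < ρ.re ∧ 0 < ρ.im ∧ ρ.im ≤ T}

/-- The sum of `β - σ` over the zeros `ρ = β + iγ` of `𝓡` with `β > σ` and `0 < γ ≤ T`, counted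
with multiplicity. -/
noncomputable def riemannAuxZeroSum (σ T : ℝ) : ℝ :=
  ∑ᶠ ρ ∈ riemannAuxZeros σ T, (analyticOrderNatAt riemannAux ρ : ℝ) * (ρ.re - σ)

/-! Write `f` for `𝓡`. On the line of slope one through `a`, the factor `e^{πi x²}` decays like a
Gaussian, and the denominator has modulus at least `1` when `a` is a half-integer. Hence the line
may be moved to the right past any number of integers, each crossing contributing a residue `n^{-s}`
(`riemannAux_eq_sum_add_auxLineIntegral`). With `a` near the saddle point `√(t / 2π)` the remaining
integral is small enough to give two facts: `f` grows at most polynomially in `t` in half planes `re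
s ≥ -k` (`exists_norm_riemannAux_le`), and `f - 1` decays exponentially in `re s` far to the right,
uniformly in `t ≥ 7` (`exists_norm_riemannAux_sub_one_le`).

The zeros enter through a form of Littlewood's lemma that avoids arguments. Let `U(t) = ∫_σ^b (x -
σ) log |f(x + it)| dx`, with `b` so large that `f` is close to `1` on and to the right of `re s =
b`. Then `U` is a primitive of a function `κ`, which off the zeros is `-∫ (x - σ) Im (f'/f) dx`. By
the Cauchy-Riemann equations and an integration by parts, the increment of `κ` over `[t', t]` is `2π
∑ (β - σ) - ∫ log |f(σ + iτ)| dτ` plus two integrals along `re s = b`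
(`exists_deriv_weightedLogIntegral`). These two are bounded, so up to `O(1)` the error to be
estimated is a difference of two values of `κ`, and it suffices to show `κ(T) = O(log T)`.

The bound for `κ` comes from approximate monotonicity. The zero sum is nondecreasing and `log |f(σ +
it)|` is at most `O(log t)`, so `κ` can fall by only `O(log T)` over a bounded interval
(`zeroSumError_le`). If `|κ(T)|` were much larger than `log T`, then `κ` would stay large with one
sign on an interval on one side of `T`, and `U` would vary there by more than `O(log T)`. But
Jensen's formula, averaged over a disc, finds in every unit interval a height where `U = O(log T)`
(`exists_line_weightedLogIntegral_ge`, `exists_log_bounds`). The contradiction is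
`abs_le_of_one_sided_bounds`, applied in `exists_abs_zeroSumError_le`. -/

/-! ### The integrand on lines of slope one. -/

open Complex in
/-- The integrand of Riemann's auxiliary function. -/
noncomputable def auxIntegrand (s x : ℂ) : ℂ :=
  x ^ (-s) * exp ((Real.pi : ℂ) * I * x ^ 2) /
      (exp ((Real.pi : ℂ) * I * x) - exp (-((Real.pi : ℂ) * I * x)))

open Complex in
/-- The point with parameter `y` on the line of slope one through `a`. -/
noncomputable def diagPoint (a y : ℝ) : ℂ := ⟨a + y, y⟩

open Complex in
theorem norm_exp_pi_sq (a y : ℝ) :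
    ‖exp ((Real.pi : ℂ) * I * (diagPoint a y) ^ 2)‖ =
      Real.exp (-(2 * Real.pi * a * y) - 2 * Real.pi * y ^ 2) := by
  rw [norm_exp]
  congr 1
  simp [diagPoint, pow_two]
  ring

-- The difference of exponentials is `2i sin (πx)`, and `|sin (u + iv)|² = sin² u + sinh² v`.
open Complex in
theorem normSq_exp_sub_exp (x : ℂ) :
    normSq (exp ((Real.pi : ℂ) * I * x) - exp (-((Real.pi : ℂ) * I * x))) =
      4 * (Real.sin (Real.pi * x.re) ^ 2 + Real.sinh (Real.pi * x.im) ^ 2) := by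
  rw [normSq_apply]
  simp only [sub_re, sub_im, exp_re, exp_im, neg_re, neg_im, mul_re, mul_im, ofReal_re, ofReal_im,
    I_re, I_im, Real.sinh_eq, Real.cos_neg, Real.sin_neg]
  have h := Real.sin_sq_add_cos_sq (Real.pi * x.re)
  have h2 : Real.exp (Real.pi * x.im) * Real.exp (-(Real.pi * x.im)) = 1 := by
    rw [← Real.exp_add]; simp
  simp only [mul_zero, zero_mul, mul_one, sub_zero, add_zero, zero_add, zero_sub, neg_neg]
  set c := Real.cos (Real.pi * x.re)
  set d := Real.sin (Real.pi * x.re)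
  set e := Real.exp (Real.pi * x.im)
  set e' := Real.exp (-(Real.pi * x.im))
  have hc : c ^ 2 = 1 - d ^ 2 := by linarith
  linear_combination (e' - e) ^ 2 * hc + 4 * d ^ 2 * h2

theorem sq_le_sinh_sq (x : ℝ) : x ^ 2 ≤ Real.sinh x ^ 2 := by
  rw [← sq_abs x, ← sq_abs (Real.sinh x), Real.abs_sinh]
  have := Real.self_le_sinh_iff.2 (abs_nonneg x)
  gcongr

-- On the line of slope one through `N + 1/2` one has `sin² (π re x) = cos² (π im x)`, while `sinh²
-- v ≥ v² ≥ sin² v`; so the sum in `normSq_exp_sub_exp` is at least `cos² + sin² = 1`. For `|im x| ≥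
-- 1` the `sinh` term is enough.
open Complex in
theorem one_le_norm_exp_sub_exp {x : ℂ}
    (h : 1 ≤ |x.im| ∨ ∃ N : ℕ, x.re = N + 1 / 2 + x.im) :
    1 ≤ ‖exp ((Real.pi : ℂ) * I * x) - exp (-((Real.pi : ℂ) * I * x))‖ := by
  have key : 1 ≤ normSq (exp ((Real.pi : ℂ) * I * x) - exp (-((Real.pi : ℂ) * I * x))) := by
    rw [normSq_exp_sub_exp]
    have h1 := sq_le_sinh_sq (Real.pi * x.im)
    have hpi := Real.pi_gt_three
    rcases h with h | ⟨N, h⟩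
    · have h2 : 1 ≤ x.im ^ 2 := by rw [← sq_abs]; nlinarith
      have h3 : 1 ≤ (Real.pi * x.im) ^ 2 := by rw [mul_pow]; nlinarith
      nlinarith [sq_nonneg (Real.sin (Real.pi * x.re))]
    · have h2 : Real.sin (Real.pi * x.re) ^ 2 = Real.cos (Real.pi * x.im) ^ 2 := by
        have : Real.pi * x.re = (Real.pi * x.im + Real.pi / 2) + N * Real.pi := by rw [h]; ring
        rw [this, Real.sin_add_nat_mul_pi, Real.sin_add_pi_div_two, mul_pow, ← pow_mul, mul_comm N,
          pow_mul]
        simp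
      have h3 := Real.sin_sq_add_cos_sq (Real.pi * x.im)
      have h4 : Real.sin (Real.pi * x.im) ^ 2 ≤ (Real.pi * x.im) ^ 2 := by
        rw [← sq_abs, ← sq_abs (Real.pi * x.im)]
        have := Real.abs_sin_le_abs (x := Real.pi * x.im)
        gcongr
      rw [h2]; nlinarith
  rw [normSq_eq_norm_sq] at key
  nlinarith [norm_nonneg (exp ((Real.pi : ℂ) * I * x) - exp (-((Real.pi : ℂ) * I * x)))]

theorem norm_sq_diagPoint (a y : ℝ) : ‖diagPoint a y‖ ^ 2 = (a + y) ^ 2 + y ^ 2 := by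
  rw [← Complex.normSq_eq_norm_sq, Complex.normSq_apply]
  simp [diagPoint]; ring

/-- The distance from the origin to the line of slope one through `a` is `|a| / √2`. -/
theorem norm_diagPoint_ge {a y c : ℝ} (h : 2 * c ^ 2 ≤ a ^ 2) : c ≤ ‖diagPoint a y‖ := by
  have := norm_sq_diagPoint a y
  apply le_of_sq_le_sq _ (norm_nonneg _)
  nlinarith [sq_nonneg (a + 2 * y)]

theorem norm_diagPoint_le {a : ℝ} (ha : 0 ≤ a) (y : ℝ) : ‖diagPoint a y‖ ≤ a + 2 * |y| := by
  have h := Complex.norm_le_abs_re_add_abs_im (diagPoint a y)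
  have h1 : |a + y| ≤ a + |y| := by
    have := abs_add_le a y
    rwa [abs_of_nonneg ha] at this
  simp only [diagPoint] at h ⊢
  linarith

theorem diagPoint_mem_slitPlane {a : ℝ} (ha : 0 < a) (y : ℝ) :
    diagPoint a y ∈ Complex.slitPlane := by
  rw [Complex.mem_slitPlane_iff]
  by_cases h : y = 0
  · left; simp [diagPoint, h, ha]
  · right; simpa [diagPoint] using h

theorem norm_cpow_neg {x : ℂ} (hx : x ≠ 0) (s : ℂ) :
    ‖x ^ (-s)‖ = ‖x‖ ^ (-s.re) * Real.exp (s.im * x.arg) := by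
  rw [Complex.norm_cpow_of_ne_zero hx, div_eq_mul_inv, ← Real.exp_neg]
  simp [mul_comm]

/-- On a line of slope one whose abscissa is close to the saddle point `√(t / 2π)`, the integrand of
the auxiliary function has Gaussian decay. -/
theorem mul_arg_diagPoint_le {a t : ℝ} (ha : 1 / 2 ≤ a) (ht : 0 ≤ t)
    (hat : |t - 2 * Real.pi * a ^ 2| ≤ 4 * Real.pi * a) (y : ℝ) :
    t * (diagPoint a y).arg - 2 * Real.pi * a * y - 2 * Real.pi * y ^ 2 ≤
      4 * Real.pi * |y| - Real.pi * y ^ 2 := by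
  have hpi := Real.pi_pos
  have ha0 : 0 < a := by linarith
  obtain ⟨hat1, hat2⟩ := abs_le.1 hat
  -- The maximum of `t arg x - 2πay` is governed by the slope at `y = 0`, where `arg x` is about `y
  -- / a` and `t / a` differs from `2πa` by at most `4π`. For `y ≥ 0` the upper bound for `t` is
  -- used, for `y < 0` the lower one.
  rcases le_or_gt 0 y with hy | hy
  · have harg : (diagPoint a y).arg ≤ y / a := by
      have hre : 0 < (diagPoint a y).re := by simp [diagPoint]; linarith
      have h1 : (diagPoint a y).arg = Real.arctan (y / (a + y)) := by
        rw [Complex.arg, if_pos hre.le, Real.arctan_eq_arcsin]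
        congr 1
        have hn := norm_sq_diagPoint a y
        have : ‖diagPoint a y‖ = (a + y) * √(1 + (y / (a + y)) ^ 2) := by
          rw [← Real.sqrt_sq (norm_nonneg _), hn]
          have hay : 0 < a + y := by linarith
          nth_rewrite 2 [← Real.sqrt_sq hay.le]
          rw [← Real.sqrt_mul (by positivity)]
          congr 1
          field_simp
        rw [this, div_div]
        rfl
      rw [h1]
      calc Real.arctan (y / (a + y)) ≤ y / (a + y) := by
            have := Real.le_tan (Real.arctan_nonneg.2 (by positivity : 0 ≤ y / (a + y)))
              (Real.arctan_lt_pi_div_two _)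
            rwa [Real.tan_arctan] at this
        _ ≤ y / a := by gcongr; linarith
    have h2 : t * (diagPoint a y).arg ≤ (2 * Real.pi * a ^ 2 + 4 * Real.pi * a) * (y / a) := by
      calc _ ≤ t * (y / a) := by gcongr
        _ ≤ _ := by gcongr; linarith
    have h3 : (2 * Real.pi * a ^ 2 + 4 * Real.pi * a) * (y / a) =
        2 * Real.pi * a * y + 4 * Real.pi * y := by field_simp
    rw [abs_of_nonneg hy]
    nlinarith [mul_nonneg hpi.le (sq_nonneg y)]
  · have hx0 : 0 < ‖diagPoint a y‖ := norm_pos_iff.2 (Complex.slitPlane_ne_zero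
      (diagPoint_mem_slitPlane ha0 y))
    have harg : (diagPoint a y).arg ≤ y / ‖diagPoint a y‖ := by
      have hneg : (diagPoint a y).arg < 0 := Complex.arg_neg_iff.2 (by simpa [diagPoint] using hy)
      have hs : Real.sin (diagPoint a y).arg = y / ‖diagPoint a y‖ := by
        rw [Complex.sin_arg]; rfl
      have := Real.sin_le (x := -(diagPoint a y).arg) (by linarith)
      rw [Real.sin_neg] at this
      linarith
    set n := ‖diagPoint a y‖ with hn
    have hnsq : n ^ 2 = (a + y) ^ 2 + y ^ 2 := norm_sq_diagPoint a y
    rw [abs_of_neg hy]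
    set v := -y with hv
    have hyv : y = -v := by simp [hv]
    have hv0 : 0 < v := by linarith
    rw [hyv] at harg hnsq ⊢
    have h2 : t * (diagPoint a (-v)).arg ≤ -(t * v / n) := by
      calc _ ≤ t * (-v / n) := by gcongr
        _ = _ := by ring
    suffices h : 2 * Real.pi * a * v - t * v / n ≤ 4 * Real.pi * v + Real.pi * v ^ 2 by
      nlinarith
    rcases le_or_gt v a with hva | hva
    · have hna : n ≤ a := by
        apply le_of_sq_le_sq _ ha0.le
        nlinarith
      have h3 : t * v / a ≤ t * v / n := by gcongr
      have h4 : (2 * Real.pi * a - 4 * Real.pi) * v ≤ t * v / a := by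
        rw [le_div_iff₀ ha0]
        nlinarith
      nlinarith [mul_pos hpi (pow_pos hv0 2)]
    -- Here `v > a`, so `n² = (v - a)² + v² ≤ 2v²`, and `7/10` is just below `1/√2`. The quadratic
    -- left over is `(a - v)² + (2/5)a²`.
    · have h3 : 7 / 10 * n ≤ v := by
        apply le_of_sq_le_sq _ hv0.le
        nlinarith
      have h4 : t * (7 / 10) ≤ t * v / n := by
        rw [mul_div_assoc]
        exact mul_le_mul_of_nonneg_left ((le_div_iff₀ hx0).2 h3) ht
      have h5 : 0 ≤ Real.pi * (7 / 5 * a ^ 2 - 2 * a * v + v ^ 2) := by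
        apply mul_nonneg hpi.le
        nlinarith [sq_nonneg (a - v)]
      nlinarith [mul_pos hpi (sub_pos.2 hva)]

/-! ### Gaussian domination and analyticity of the line integrals. -/

open Complex in
/-- The integral of `auxIntegrand s` along the line through `a` with direction `e^{-3πi/4}`. -/
noncomputable def auxLineIntegral (a : ℝ) (s : ℂ) : ℂ :=
  ∫ u : ℝ, auxIntegrand s (a + u * exp (-(3 * (Real.pi : ℂ) / 4) * I)) *
    exp (-(3 * (Real.pi : ℂ) / 4) * I)

theorem riemannAux_eq_auxLineIntegral (s : ℂ) : riemannAux s = auxLineIntegral (1 / 2) s := by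
  simp [riemannAux, auxLineIntegral, auxIntegrand, swLine]

open Complex in
theorem exp_neg_three_pi_div_four :
    exp (-(3 * (Real.pi : ℂ) / 4) * I) = ⟨-(√2 / 2), -(√2 / 2)⟩ := by
  have h : -(3 * (Real.pi : ℂ) / 4) * I = ((-(3 * Real.pi / 4) : ℝ) : ℂ) * I := by push_cast; ring
  have h3 : 3 * Real.pi / 4 = Real.pi - Real.pi / 4 := by ring
  rw [h, exp_mul_I, ← ofReal_cos, ← ofReal_sin, Real.cos_neg, Real.sin_neg, h3, Real.cos_pi_sub,
    Real.sin_pi_sub, Real.cos_pi_div_four, Real.sin_pi_div_four]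
  apply Complex.ext <;> simp

open Complex in
theorem add_mul_exp_eq_diagPoint (a u : ℝ) :
    (a : ℂ) + u * exp (-(3 * (Real.pi : ℂ) / 4) * I) = diagPoint a (-(√2 / 2) * u) := by
  rw [exp_neg_three_pi_div_four, diagPoint]
  apply Complex.ext <;> simp <;> ring

open Complex in
theorem norm_exp_neg_three_pi_div_four : ‖exp (-(3 * (Real.pi : ℂ) / 4) * I)‖ = 1 := by
  rw [norm_exp]; simp

theorem half_sqrt_two_mul_sq (u : ℝ) : (-(√2 / 2) * u) ^ 2 = u ^ 2 / 2 := by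
  rw [mul_pow, neg_sq, div_pow, Real.sq_sqrt (by norm_num)]; ring

/-- Both signs of `σ` are covered at once: `r` and `r⁻¹` are both at most `4 + r`. A lower bound of
`1/4` is available on every line with `a ≥ 1/2`, by `norm_diagPoint_ge`. -/
theorem rpow_neg_le_four_add_pow {r σ : ℝ} {k : ℕ} (hr : 1 / 4 ≤ r) (hk : |σ| ≤ k) :
    r ^ (-σ) ≤ (4 + r) ^ k := by
  have h0 : 0 < r := by linarith
  obtain ⟨h1, h2⟩ := abs_le.1 hk
  rcases le_total 1 r with h | h
  · calc r ^ (-σ) ≤ r ^ (k : ℝ) := Real.rpow_le_rpow_of_exponent_le h (by linarith)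
      _ = r ^ k := Real.rpow_natCast _ _
      _ ≤ (4 + r) ^ k := by gcongr; linarith
  · calc r ^ (-σ) ≤ r ^ (-(k : ℝ)) := Real.rpow_le_rpow_of_exponent_ge h0 h (by linarith)
      _ = (r⁻¹) ^ k := by rw [Real.rpow_neg h0.le, Real.rpow_natCast, inv_pow]
      _ ≤ (4 + r) ^ k := by
        gcongr
        have : r⁻¹ ≤ 4 := by rw [inv_le_comm₀ h0 (by norm_num)]; linarith
        linarith

theorem pow_mul_exp_le_gaussian (A c : ℝ) (hA : 0 ≤ A) (k : ℕ) :
    ∃ C : ℝ, 0 ≤ C ∧ ∀ y : ℝ, (A + 2 * |y|) ^ k * Real.exp (c * |y| - Real.pi * y ^ 2) ≤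
      C * Real.exp (-y ^ 2) := by
  -- The power costs `k! e^{A + 2|y|}`. Then `(c + 2)|y| ≤ 2y² + (c + 2)²/8`, and `π > 3` pays for
  -- `2y²` and leaves `e^{-y²}`.
  refine ⟨k.factorial * Real.exp (A + (c + 2) ^ 2 / 8), by positivity, fun y => ?_⟩
  have h1 : (A + 2 * |y|) ^ k ≤ k.factorial * Real.exp (A + 2 * |y|) := by
    have := Real.pow_div_factorial_le_exp (A + 2 * |y|) (by positivity) k
    rw [div_le_iff₀ (by positivity)] at this
    linarith
  calc _ ≤ k.factorial * Real.exp (A + 2 * |y|) * Real.exp (c * |y| - Real.pi * y ^ 2) := by gcongr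
    _ = k.factorial * Real.exp (A + 2 * |y| + (c * |y| - Real.pi * y ^ 2)) := by
      rw [mul_assoc, ← Real.exp_add]
    _ ≤ k.factorial * Real.exp (A + (c + 2) ^ 2 / 8 + -y ^ 2) := by
      have := Real.pi_gt_three
      have hy := sq_abs y
      have hle : A + 2 * |y| + (c * |y| - Real.pi * y ^ 2) ≤ A + (c + 2) ^ 2 / 8 + -y ^ 2 := by
        nlinarith [sq_nonneg (4 * |y| - (c + 2)), sq_nonneg y]
      gcongr
    _ = _ := by rw [Real.exp_add, mul_assoc]

theorem norm_auxIntegrand_diagPoint_le {a y : ℝ} (ha : 0 < a)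
    (h : 1 ≤ |y| ∨ ∃ N : ℕ, a = N + 1 / 2) (s : ℂ) :
    ‖auxIntegrand s (diagPoint a y)‖ ≤ ‖diagPoint a y‖ ^ (-s.re) *
      Real.exp (s.im * (diagPoint a y).arg - 2 * Real.pi * a * y - 2 * Real.pi * y ^ 2) := by
  have hx := Complex.slitPlane_ne_zero (diagPoint_mem_slitPlane ha y)
  rw [auxIntegrand, norm_div, norm_mul, norm_cpow_neg hx, norm_exp_pi_sq, mul_assoc, ← Real.exp_add]
  have hden := one_le_norm_exp_sub_exp (x := diagPoint a y) (by
    rcases h with h | ⟨N, h⟩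
    · left; exact h
    · right; exact ⟨N, by simp [diagPoint, h]⟩)
  refine (div_le_self (by positivity) hden).trans (le_of_eq ?_)
  congr 2
  ring

/-- A bound for the integrand that is locally uniform in `s`. -/
theorem norm_auxIntegrand_diagPoint_le_of_abs_le {a A y T : ℝ} (ha : 1 / 2 ≤ a) (haA : a ≤ A)
    (h : 1 ≤ |y| ∨ ∃ N : ℕ, a = N + 1 / 2) {k : ℕ} {s : ℂ} (hk : |s.re| ≤ k) (hT : |s.im| ≤ T) :
    ‖auxIntegrand s (diagPoint a y)‖ ≤ Real.exp (T * Real.pi) * ((4 + A + 2 * |y|) ^ k *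
      Real.exp (2 * Real.pi * A * |y| - Real.pi * y ^ 2)) := by
  have ha0 : 0 < a := by linarith
  have hx1 : 1 / 4 ≤ ‖diagPoint a y‖ := norm_diagPoint_ge (by nlinarith)
  have hx2 := norm_diagPoint_le ha0.le y
  have hpi := Real.pi_pos
  calc _ ≤ ‖diagPoint a y‖ ^ (-s.re) *
      Real.exp (s.im * (diagPoint a y).arg - 2 * Real.pi * a * y - 2 * Real.pi * y ^ 2) :=
      norm_auxIntegrand_diagPoint_le ha0 h s
    _ ≤ (4 + A + 2 * |y|) ^ k *
      Real.exp (T * Real.pi + (2 * Real.pi * A * |y| - Real.pi * y ^ 2)) := by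
      have hA : 0 ≤ A := by linarith
      refine mul_le_mul ?_ (Real.exp_le_exp.2 ?_) (by positivity) (by positivity)
      · refine (rpow_neg_le_four_add_pow hx1 hk).trans ?_
        have h5 : 4 + ‖diagPoint a y‖ ≤ 4 + A + 2 * |y| := by linarith
        gcongr
      · have h1 : s.im * (diagPoint a y).arg ≤ T * Real.pi := by
          calc _ ≤ |s.im * (diagPoint a y).arg| := le_abs_self _
            _ = |s.im| * |(diagPoint a y).arg| := abs_mul _ _
            _ ≤ T * Real.pi := by
              gcongr
              · exact (abs_nonneg _).trans hT
              · exact Complex.abs_arg_le_pi _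
        have h2 : -(2 * Real.pi * a * y) ≤ 2 * Real.pi * A * |y| := by
          calc _ = 2 * Real.pi * a * (-y) := by ring
            _ ≤ 2 * Real.pi * A * |y| := by
              have : -y ≤ |y| := neg_le_abs y
              have h3 : a * (-y) ≤ A * |y| := by
                have := abs_nonneg y
                nlinarith
              nlinarith
        nlinarith [mul_nonneg hpi.le (sq_nonneg y)]
    _ = _ := by rw [Real.exp_add]; ring

/-- Uniformity in `a` is what contour shifting needs: besides integrability on half-integer lines
(any `y`), it controls the far ends (`|y| ≥ 1`) of the strip between two such lines. -/
theorem exists_gaussian_bound_auxIntegrand (A T : ℝ) (hA : 0 ≤ A) (k : ℕ) :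
    ∃ C : ℝ, 0 ≤ C ∧ ∀ a y : ℝ, ∀ s : ℂ, 1 / 2 ≤ a → a ≤ A → (1 ≤ |y| ∨ ∃ N : ℕ, a = N + 1 / 2) →
      |s.re| ≤ k → |s.im| ≤ T →
      ‖auxIntegrand s (diagPoint a y)‖ ≤ C * Real.exp (-y ^ 2) := by
  obtain ⟨C, hC, h⟩ := pow_mul_exp_le_gaussian (4 + A) (2 * Real.pi * A) (by linarith) k
  refine ⟨Real.exp (T * Real.pi) * C, by positivity, fun a y s h1 h2 h3 h4 h5 => ?_⟩
  refine (norm_auxIntegrand_diagPoint_le_of_abs_le h1 h2 h3 h4 h5).trans ?_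
  rw [mul_assoc (Real.exp (T * Real.pi))]
  exact mul_le_mul_of_nonneg_left (h y) (by positivity)

theorem exp_sub_exp_ne_zero_of_half (N : ℕ) (y : ℝ) :
    Complex.exp ((Real.pi : ℂ) * Complex.I * diagPoint (N + 1 / 2) y) -
      Complex.exp (-((Real.pi : ℂ) * Complex.I * diagPoint (N + 1 / 2) y)) ≠ 0 := by
  have := one_le_norm_exp_sub_exp (x := diagPoint (N + 1 / 2) y) (Or.inr ⟨N, by simp [diagPoint]⟩)
  exact norm_pos_iff.1 (by linarith)

theorem continuous_diagPoint (a : ℝ) : Continuous (diagPoint a) := by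
  have : diagPoint a = fun y : ℝ => (a : ℂ) + y + y * Complex.I := by
    ext y; apply Complex.ext <;> simp [diagPoint]
  rw [this]; fun_prop

theorem continuous_auxIntegrand_diagPoint (N : ℕ) (s : ℂ) :
    Continuous fun y : ℝ => auxIntegrand s (diagPoint (N + 1 / 2) y) := by
  unfold auxIntegrand
  have h := continuous_diagPoint (N + 1 / 2)
  refine Continuous.div (Continuous.mul ?_ (by fun_prop)) (by fun_prop)
    (exp_sub_exp_ne_zero_of_half N)
  exact h.cpow continuous_const fun y => diagPoint_mem_slitPlane (by positivity) y

theorem integrable_exp_neg_half_sq : MeasureTheory.Integrable fun u : ℝ => Real.exp (-(u ^ 2 / 2)) := by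
  convert integrable_exp_neg_mul_sq (b := 1 / 2) (by norm_num) using 3
  ring

open Complex in
theorem integrable_auxIntegrand_line (N : ℕ) (s : ℂ) :
    MeasureTheory.Integrable fun u : ℝ =>
      auxIntegrand s ((N + 1 / 2 : ℝ) + u * exp (-(3 * (Real.pi : ℂ) / 4) * I)) *
        exp (-(3 * (Real.pi : ℂ) / 4) * I) := by
  apply MeasureTheory.Integrable.mul_const
  obtain ⟨k, hk⟩ := exists_nat_ge |s.re|
  obtain ⟨C, hC, h⟩ := exists_gaussian_bound_auxIntegrand (N + 1 / 2) |s.im| (by positivity) k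
  refine (integrable_exp_neg_half_sq.const_mul C).mono' ?_ (Filter.Eventually.of_forall fun u => ?_)
  · simp_rw [add_mul_exp_eq_diagPoint]
    exact ((continuous_auxIntegrand_diagPoint N s).comp
      (continuous_const.mul continuous_id)).aestronglyMeasurable
  · rw [add_mul_exp_eq_diagPoint]
    refine (h _ _ s (by simp) le_rfl (Or.inr ⟨N, rfl⟩) hk le_rfl).trans (le_of_eq ?_)
    rw [half_sqrt_two_mul_sq]

/-- If the integrand on the line is dominated by a Gaussian, so is the integral. -/
theorem norm_auxLineIntegral_le {a C : ℝ} {s : ℂ}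
    (h : ∀ y : ℝ, ‖auxIntegrand s (diagPoint a y)‖ ≤ C * Real.exp (-y ^ 2)) :
    ‖auxLineIntegral a s‖ ≤ C * √(2 * Real.pi) := by
  rw [auxLineIntegral]
  have hg : ∫ u : ℝ, Real.exp (-(u ^ 2 / 2)) = √(2 * Real.pi) := by
    have := integral_gaussian (1 / 2)
    rw [show Real.pi / (1 / 2) = 2 * Real.pi by ring] at this
    rw [← this]
    congr 1; ext u; congr 1; ring
  calc _ ≤ ∫ u : ℝ, C * Real.exp (-(u ^ 2 / 2)) := by
        refine MeasureTheory.norm_integral_le_of_norm_le (integrable_exp_neg_half_sq.const_mul C)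
          (Filter.Eventually.of_forall fun u => ?_)
        rw [norm_mul, norm_exp_neg_three_pi_div_four, mul_one, add_mul_exp_eq_diagPoint]
        refine (h _).trans (le_of_eq ?_)
        rw [half_sqrt_two_mul_sq]
    _ = _ := by rw [MeasureTheory.integral_const_mul, hg]

theorem abs_log_le_four_add {r : ℝ} (hr : 1 / 4 ≤ r) : |Real.log r| ≤ 4 + r := by
  have h0 : 0 < r := by linarith
  rw [abs_le]
  constructor
  · have := Real.log_le_self (x := r⁻¹) (by positivity)
    rw [Real.log_inv] at this
    have h2 : r⁻¹ ≤ 4 := by rw [inv_le_comm₀ h0 (by norm_num)]; linarith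
    linarith
  · have := Real.log_le_self h0.le
    linarith

-- Differentiation under the integral sign. The `s`-derivative of the integrand brings down `log x`,
-- which grows at most linearly along the line, so it only raises the power in the Gaussian bound by
-- one.
open Complex in
theorem differentiable_auxLineIntegral (N : ℕ) : Differentiable ℂ (auxLineIntegral (N + 1 / 2)) := by
  intro s₀
  set ω : ℂ := exp (-(3 * (Real.pi : ℂ) / 4) * I) with hω
  set x : ℝ → ℂ := fun u => ((N + 1 / 2 : ℝ) : ℂ) + u * ω with hx
  have hxd : ∀ u, x u = diagPoint (N + 1 / 2) (-(√2 / 2) * u) := fun u => add_mul_exp_eq_diagPoint _ _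
  have hx0 : ∀ u, x u ≠ 0 := fun u => by
    rw [hxd]; exact slitPlane_ne_zero (diagPoint_mem_slitPlane (by positivity) _)
  -- The added `1` makes the exponent valid on the whole unit ball around `s₀`.
  obtain ⟨k, hk⟩ := exists_nat_ge (|s₀.re| + 1)
  obtain ⟨C, hC, hbound⟩ := pow_mul_exp_le_gaussian (8 + (N + 1 / 2)) (2 * Real.pi * (N + 1 / 2))
    (by positivity) (k + 1)
  set E := Real.exp ((|s₀.im| + 1) * Real.pi)
  have hdiff : ∀ (u : ℝ) (s : ℂ), HasDerivAt (fun s => auxIntegrand s (x u) * ω)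
      (-(Complex.log (x u)) * auxIntegrand s (x u) * ω) s := by
    intro u s
    have h1 : HasDerivAt (fun s : ℂ => x u ^ (-s)) (x u ^ (-s) * Complex.log (x u) * (-1)) s :=
      (hasDerivAt_neg s).const_cpow (Or.inl (hx0 u))
    have h2 := ((h1.mul_const (exp ((Real.pi : ℂ) * I * x u ^ 2))).div_const
      (exp ((Real.pi : ℂ) * I * x u) - exp (-((Real.pi : ℂ) * I * x u)))).mul_const ω
    refine h2.congr_deriv ?_
    rw [auxIntegrand]; ring
  have hmeas : ∀ s, MeasureTheory.AEStronglyMeasurable (fun u => auxIntegrand s (x u) * ω)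
      MeasureTheory.volume := fun s => (integrable_auxIntegrand_line N s).aestronglyMeasurable
  refine (hasDerivAt_integral_of_dominated_loc_of_deriv_le (F := fun s u => auxIntegrand s (x u) * ω)
    (F' := fun s u => -(Complex.log (x u)) * auxIntegrand s (x u) * ω)
    (bound := fun u => E * C * Real.exp (-(u ^ 2 / 2)))
    (Metric.ball_mem_nhds s₀ one_pos) (Filter.Eventually.of_forall hmeas)
    (integrable_auxIntegrand_line N s₀) ?_ (Filter.Eventually.of_forall ?_)
    (integrable_exp_neg_half_sq.const_mul _)
    (Filter.Eventually.of_forall fun u s _ => hdiff u s)).2.differentiableAt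
  · have hc : Continuous fun u => Complex.log (x u) := by
      have : Continuous x := by fun_prop
      refine this.clog fun u => ?_
      rw [hxd]; exact diagPoint_mem_slitPlane (by positivity) _
    have := hc.neg.aestronglyMeasurable.mul (hmeas s₀)
    refine this.congr (Filter.Eventually.of_forall fun u => ?_)
    simp [mul_assoc]
  · intro u s hs
    have hs1 : |s.re| ≤ k := by
      have := (abs_re_le_norm (s - s₀)).trans (mem_ball_iff_norm.1 hs).le
      rw [sub_re] at this
      linarith [abs_sub_abs_le_abs_sub s.re s₀.re]
    have hs2 : |s.im| ≤ |s₀.im| + 1 := by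
      have := (abs_im_le_norm (s - s₀)).trans (mem_ball_iff_norm.1 hs).le
      rw [sub_im] at this
      linarith [abs_sub_abs_le_abs_sub s.im s₀.im]
    rw [norm_mul, hω, norm_exp_neg_three_pi_div_four, mul_one, norm_mul, norm_neg, hxd]
    set y := -(√2 / 2) * u with hy
    have h1 := norm_auxIntegrand_diagPoint_le_of_abs_le (a := N + 1 / 2) (y := y) (by simp) le_rfl
      (Or.inr ⟨N, rfl⟩) hs1 hs2
    have h2 : ‖Complex.log (diagPoint (N + 1 / 2) y)‖ ≤ 8 + (N + 1 / 2) + 2 * |y| := by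
      refine (norm_le_abs_re_add_abs_im _).trans ?_
      rw [log_re, log_im]
      have h3 := abs_log_le_four_add (r := ‖diagPoint (N + 1 / 2 : ℝ) y‖)
        (norm_diagPoint_ge (by nlinarith [sq_nonneg (N : ℝ), (Nat.cast_nonneg N : (0 : ℝ) ≤ N)]))
      have h4 := abs_arg_le_pi (diagPoint (N + 1 / 2 : ℝ) y)
      have h5 := norm_diagPoint_le (a := N + 1 / 2) (by positivity) y
      linarith [Real.pi_lt_four]
    calc _ ≤ (8 + (N + 1 / 2 : ℝ) + 2 * |y|) * (E * ((8 + (N + 1 / 2 : ℝ) + 2 * |y|) ^ k *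
          Real.exp (2 * Real.pi * (N + 1 / 2) * |y| - Real.pi * y ^ 2))) := by
          gcongr
          refine h1.trans ?_
          gcongr
          linarith
      _ = E * ((8 + (N + 1 / 2 : ℝ) + 2 * |y|) ^ (k + 1) *
          Real.exp (2 * Real.pi * (N + 1 / 2) * |y| - Real.pi * y ^ 2)) := by ring
      _ ≤ E * (C * Real.exp (-y ^ 2)) := 
        mul_le_mul_of_nonneg_left (hbound y) (by positivity)
      _ = _ := by rw [hy, half_sqrt_two_mul_sq, mul_assoc]

theorem differentiable_riemannAux : Differentiable ℂ riemannAux := by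
  have h := differentiable_auxLineIntegral 0
  have : riemannAux = auxLineIntegral ((0 : ℕ) + 1 / 2) := by
    ext s; rw [riemannAux_eq_auxLineIntegral]; simp
  rwa [this]

/-! ### Shifting the line across integers: the approximate functional equation. -/

open Complex Filter Topology MeasureTheory in
/-- The residue theorem for a strip and a function with one simple pole. -/
theorem integral_strip_sub_eq_two_pi_I_mul {G : ℂ → ℂ} {h K₀ : ℝ} {ε : ℝ → ℝ} (hh : 0 < h)
    (hG : DifferentiableOn ℂ G {w | |w.im| ≤ h})
    (hε : Tendsto ε atTop (𝓝 0))
    (hdecay : ∀ w : ℂ, |w.im| ≤ h → K₀ ≤ |w.re| → ‖G w / w‖ ≤ ε |w.re|)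
    (hi₁ : Integrable fun x : ℝ => G (x + (-h : ℝ) * I) / (x + (-h : ℝ) * I))
    (hi₂ : Integrable fun x : ℝ => G (x + h * I) / (x + h * I)) :
    (∫ x : ℝ, G (x + (-h : ℝ) * I) / (x + (-h : ℝ) * I)) - (∫ x : ℝ, G (x + h * I) / (x + h * I)) =
      2 * Real.pi * I * G 0 := by
  set S : Set ℂ := {w | |w.im| ≤ h} with hS
  have hS0 : S ∈ 𝓝 (0 : ℂ) := by
    have : Tendsto (fun w : ℂ => |w.im|) (𝓝 0) (𝓝 0) := by
      have h1 : Continuous fun w : ℂ => |w.im| := by fun_prop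
      simpa using h1.tendsto 0
    exact (this.eventually (gt_mem_nhds hh)).mono fun w hw => le_of_lt hw
  -- Cauchy's theorem is applied to `(G w - G 0) / w`, whose singularity is removable. The polar
  -- part `G 0 / w` is integrated explicitly over the two horizontal sides, which gives `4 arctan (K
  -- / h)`, tending to `2π`.
  have hD : DifferentiableOn ℂ (dslope G 0) S := (differentiableOn_dslope hS0).2 hG
  have hDw : ∀ w : ℂ, w ≠ 0 → dslope G 0 w = G w / w - G 0 / w := by
    intro w hw
    rw [dslope_of_ne _ hw, slope_def_field, sub_zero, sub_div]
  have hne : ∀ x : ℝ, ∀ c : ℝ, c ≠ 0 → (x : ℂ) + c * I ≠ 0 := fun x c hc h0 => by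
    have := congrArg Complex.im h0
    simp at this; exact hc this
  have hcinv : ∀ c : ℝ, c ≠ 0 → ∀ K : ℝ,
      IntervalIntegrable (fun x : ℝ => G 0 / ((x : ℂ) + c * I)) volume (-K) K := fun c hc K => by
    apply Continuous.intervalIntegrable
    exact Continuous.div (by fun_prop) (by fun_prop) fun x => hne x c hc
  have hrect : ∀ K : ℝ, 0 < K →
      ((∫ x : ℝ in (-K)..K, G (x + (-h : ℝ) * I) / (x + (-h : ℝ) * I)) -
        (∫ x : ℝ in (-K)..K, G (x + h * I) / (x + h * I))) =
        G 0 * (4 * Real.arctan (K / h) : ℝ) * I +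
        (-(I • (∫ y : ℝ in (-h)..h, dslope G 0 ((K : ℝ) + y * I))) +
          I • (∫ y : ℝ in (-h)..h, dslope G 0 ((-K : ℝ) + y * I))) := by
    intro K hK
    have key := integral_boundary_rect_eq_zero_of_differentiableOn (dslope G 0) ⟨-K, -h⟩ ⟨K, h⟩
      (hD.mono fun w hw => by
        rw [Complex.mem_reProdIm, Set.uIcc_of_le (by linarith : -h ≤ h)] at hw
        exact abs_le.2 hw.2)
    simp only at key
    have e1 : ∀ c : ℝ, c ≠ 0 →
        Integrable (fun x : ℝ => G (x + c * I) / (x + c * I)) →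
        (∫ x : ℝ in (-K)..K, dslope G 0 (x + c * I)) =
          (∫ x : ℝ in (-K)..K, G (x + c * I) / (x + c * I)) -
            ∫ x : ℝ in (-K)..K, G 0 / ((x : ℂ) + c * I) := fun c hc hi => by
      rw [← intervalIntegral.integral_sub hi.intervalIntegrable (hcinv c hc K)]
      exact intervalIntegral.integral_congr fun x _ => hDw _ (hne x c hc)
    rw [e1 (-h) (by linarith) hi₁, e1 h hh.ne' hi₂] at key
    have e2 : (∫ x : ℝ in (-K)..K, G 0 / ((x : ℂ) + (-h : ℝ) * I)) -
        (∫ x : ℝ in (-K)..K, G 0 / ((x : ℂ) + h * I)) =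
        G 0 * (4 * Real.arctan (K / h) : ℝ) * I := by
      rw [← intervalIntegral.integral_sub (hcinv _ (by linarith) K) (hcinv h hh.ne' K)]
      have e3 : ∀ x : ℝ, G 0 / ((x : ℂ) + (-h : ℝ) * I) - G 0 / ((x : ℂ) + h * I) =
          (2 * G 0 * I / h) * ((1 / (1 + (x / h) ^ 2) : ℝ) : ℂ) := by
        intro x
        have h1 := hne x (-h) (by linarith)
        have h2 := hne x h hh.ne'
        have h3 : (h : ℂ) ≠ 0 := by exact_mod_cast hh.ne'
        have h4 : ((1 : ℂ) + (x / h) ^ 2) ≠ 0 := by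
          have : (1 + (x / h) ^ 2 : ℝ) ≠ 0 := by positivity
          exact_mod_cast this
        push_cast at h1 ⊢
        have h5 : (1 : ℂ) + (x / h) ^ 2 = (x + -h * I) * (x + h * I) / h ^ 2 := by
          field_simp
          linear_combination (h : ℂ) ^ 2 * I_sq
        rw [h5]
        have h6 : (x : ℂ) - h * I ≠ 0 := by rwa [neg_mul, ← sub_eq_add_neg] at h1
        rw [neg_mul, ← sub_eq_add_neg]
        field_simp
        ring
      simp_rw [e3]
      rw [intervalIntegral.integral_const_mul, intervalIntegral.integral_ofReal,
        intervalIntegral.integral_comp_div (fun x => 1 / (1 + x ^ 2)) hh.ne',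
        integral_one_div_one_add_sq, neg_div, Real.arctan_neg]
      have h3 : (h : ℂ) ≠ 0 := by exact_mod_cast hh.ne'
      push_cast [smul_eq_mul]
      field_simp
      ring
    push_cast at key e2 ⊢
    linear_combination key + e2
  have hvert : ∀ g : ℝ → ℝ, (∀ K, |g K| = |K|) →
      Tendsto (fun K : ℝ => ∫ y : ℝ in (-h)..h, dslope G 0 (((g K : ℝ) : ℂ) + y * I)) atTop (𝓝 0) := by
    intro g hg
    have hb : Tendsto (fun K : ℝ => (ε K + ‖G 0‖ / K) * |h - -h|) atTop (𝓝 0) := by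
      have h1 : Tendsto (fun K : ℝ => ‖G 0‖ / K) atTop (𝓝 0) := tendsto_const_nhds.div_atTop tendsto_id
      simpa using (hε.add h1).mul_const |h - -h|
    refine squeeze_zero_norm' ?_ hb
    filter_upwards [eventually_gt_atTop 0, eventually_ge_atTop K₀] with K hK hK₀
    apply intervalIntegral.norm_integral_le_of_norm_le_const
    intro y hy
    rw [Set.uIoc_of_le (by linarith)] at hy
    have hre : |(((g K : ℝ) : ℂ) + y * I).re| = K := by simp [hg, abs_of_pos hK]
    have him : |(((g K : ℝ) : ℂ) + y * I).im| ≤ h := by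
      simpa using abs_le.2 ⟨hy.1.le, hy.2⟩
    have hn : K ≤ ‖((g K : ℝ) : ℂ) + y * I‖ :=
      hre.symm.le.trans (abs_re_le_norm _)
    have hw0 : ((g K : ℝ) : ℂ) + y * I ≠ 0 := norm_pos_iff.1 (by linarith)
    rw [hDw _ hw0]
    refine (norm_sub_le _ _).trans (add_le_add ?_ ?_)
    · have := hdecay _ him (by rw [hre]; exact hK₀)
      rwa [hre] at this
    · rw [norm_div]; gcongr
  have hl1 : ∀ {F : ℝ → ℂ}, Integrable F →
      Tendsto (fun K : ℝ => ∫ x in (-K)..K, F x) atTop (𝓝 (∫ x, F x)) := fun hF =>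
    intervalIntegral_tendsto_integral hF tendsto_neg_atTop_atBot tendsto_id
  have hl2 := (hl1 hi₁).sub (hl1 hi₂)
  have hl3 : Tendsto (fun K : ℝ => G 0 * (4 * Real.arctan (K / h) : ℝ) * I +
        (-(I • (∫ y : ℝ in (-h)..h, dslope G 0 ((K : ℝ) + y * I))) +
          I • (∫ y : ℝ in (-h)..h, dslope G 0 ((-K : ℝ) + y * I)))) atTop
      (𝓝 (G 0 * (4 * (Real.pi / 2) : ℝ) * I + (-(I • 0) + I • 0))) := by
    have h1 : Tendsto (fun K : ℝ => Real.arctan (K / h)) atTop (𝓝 (Real.pi / 2)) :=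
      (tendsto_nhds_of_tendsto_nhdsWithin Real.tendsto_arctan_atTop).comp
        (tendsto_id.atTop_div_const hh)
    refine Tendsto.add ?_ (Tendsto.add ?_ ?_)
    · exact (((continuous_ofReal.tendsto _).comp (h1.const_mul 4)).const_mul (G 0)).mul_const I
    · exact ((hvert (fun K => K) fun _ => rfl).const_smul I).neg
    · exact (hvert (fun K => -K) fun _ => abs_neg _).const_smul I
  have := tendsto_nhds_unique (hl2.congr' ((eventually_gt_atTop 0).mono hrect)) hl3
  rw [this]
  push_cast
  simp
  ring

open Complex in
/-- The denominator of `auxIntegrand`. -/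
noncomputable def auxDenom (x : ℂ) : ℂ :=
  exp ((Real.pi : ℂ) * I * x) - exp (-((Real.pi : ℂ) * I * x))

open Complex in
theorem exp_pi_I_mul_natCast (m : ℕ) : exp ((Real.pi : ℂ) * I * m) = (-1) ^ m := by
  rw [mul_comm, exp_nat_mul, exp_pi_mul_I]

open Complex in
theorem exp_neg_pi_I_mul_natCast (m : ℕ) : exp (-((Real.pi : ℂ) * I * m)) = (-1) ^ m := by
  rw [exp_neg, exp_pi_I_mul_natCast, ← inv_pow]; norm_num

theorem auxDenom_natCast (m : ℕ) : auxDenom m = 0 := by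
  rw [auxDenom, exp_pi_I_mul_natCast, exp_neg_pi_I_mul_natCast, sub_self]

open Complex in
theorem hasDerivAt_auxDenom (x : ℂ) : HasDerivAt auxDenom
    ((Real.pi : ℂ) * I * (exp ((Real.pi : ℂ) * I * x) + exp (-((Real.pi : ℂ) * I * x)))) x := by
  have h1 : HasDerivAt (fun x : ℂ => (Real.pi : ℂ) * I * x) ((Real.pi : ℂ) * I) x := by
    simpa using (hasDerivAt_id x).const_mul ((Real.pi : ℂ) * I)
  refine (h1.cexp.sub h1.neg.cexp).congr_deriv ?_
  simp only [Pi.neg_apply]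
  ring

open Complex in
theorem dslope_auxDenom_natCast (m : ℕ) :
    dslope auxDenom m m = 2 * Real.pi * I * (-1) ^ m := by
  rw [dslope_same, (hasDerivAt_auxDenom m).deriv, exp_pi_I_mul_natCast, exp_neg_pi_I_mul_natCast]
  ring

theorem auxDenom_eq_mul_dslope (m : ℕ) (x : ℂ) :
    auxDenom x = (x - m) * dslope auxDenom m x := by
  have := sub_smul_dslope auxDenom (m : ℂ) x
  rw [auxDenom_natCast, sub_zero] at this
  rw [← this, smul_eq_mul]

-- The zeros of the denominator are the integers, all simple; a strip of horizontal half-width `1/2`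
-- around the slope-one line through `m` contains only `m`, and there `dslope` is the nonzero
-- derivative.
open Complex in
theorem dslope_auxDenom_ne_zero {m : ℕ} {x : ℂ} (h : |x.re - x.im - m| ≤ 1 / 2) :
    dslope auxDenom m x ≠ 0 := by
  intro h0
  by_cases hxm : x = m
  · rw [hxm, dslope_auxDenom_natCast] at h0
    have : (Real.pi : ℂ) ≠ 0 := by exact_mod_cast Real.pi_ne_zero
    simp [this, I_ne_zero] at h0
  · have h1 : auxDenom x = 0 := by rw [auxDenom_eq_mul_dslope m, h0, mul_zero]
    have h2 := normSq_exp_sub_exp x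
    rw [← auxDenom, h1, map_zero] at h2
    have h3 : Real.sin (Real.pi * x.re) = 0 := by
      nlinarith [sq_nonneg (Real.sin (Real.pi * x.re)), sq_nonneg (Real.sinh (Real.pi * x.im))]
    have h4 : Real.sinh (Real.pi * x.im) = 0 := by
      nlinarith [sq_nonneg (Real.sin (Real.pi * x.re)), sq_nonneg (Real.sinh (Real.pi * x.im))]
    have h5 : x.im = 0 := by
      rw [Real.sinh_eq_zero] at h4
      exact (mul_eq_zero.1 h4).resolve_left Real.pi_ne_zero
    obtain ⟨n, hn⟩ := Real.sin_eq_zero_iff.1 h3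
    have h6 : x.re = n := by
      have := Real.pi_ne_zero
      rw [mul_comm] at hn
      exact (mul_left_cancel₀ this hn).symm
    rw [h5, h6, sub_zero] at h
    have h7 : |(n : ℤ) - (m : ℤ)| < 1 := by
      have : |(((n : ℤ) - (m : ℤ) : ℤ) : ℝ)| < 1 := by push_cast; linarith
      exact_mod_cast this
    have h8 : n = m := by rw [Int.abs_lt_one_iff] at h7; omega
    exact hxm (by apply Complex.ext <;> simp [h5, h6, h8])

open Complex in
/-- Moving the line of integration across the integer `m` picks up the term `m ^ (-s)`. -/
theorem auxLineIntegral_sub_auxLineIntegral (m : ℕ) (s : ℂ) :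
    auxLineIntegral (m + 1 / 2) s - auxLineIntegral ((m + 1 : ℕ) + 1 / 2) s =
      ((m + 1 : ℕ) : ℂ) ^ (-s) := by
  set M : ℕ := m + 1 with hM
  have hM1 : (1 : ℝ) ≤ M := by simp [hM]
  set ω : ℂ := exp (-(3 * (Real.pi : ℂ) / 4) * I) with hω
  have hω0 : ω ≠ 0 := exp_ne_zero _
  have hs2 : √2 ^ 2 = 2 := Real.sq_sqrt (by norm_num)
  have hs0 : 0 < √2 := by positivity
  -- In the coordinate `w`, with `x = M + ωw`, the slope-one lines become horizontal, and `im w = q`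
  -- is the line through `M + √2 q`. So `±√2/4` correspond to the half-integers `M ± 1/2`.
  set h : ℝ := √2 / 4 with hh
  have hh0 : 0 < h := by positivity
  set X : ℂ → ℂ := fun w => (M : ℂ) + ω * w with hX
  have hXd : ∀ w, X w = diagPoint (M + √2 * w.im) (-(√2 / 2) * (w.re + w.im)) := by
    intro w
    rw [hX, hω, exp_neg_three_pi_div_four, diagPoint]
    apply Complex.ext <;> simp <;> ring
  set G : ℂ → ℂ := fun w => X w ^ (-s) * exp ((Real.pi : ℂ) * I * X w ^ 2) /
    dslope auxDenom M (X w) with hG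
  have hGw : ∀ w, w ≠ 0 → G w / w = auxIntegrand s (X w) * ω := by
    intro w hw
    have h1 : auxDenom (X w) = ω * w * dslope auxDenom M (X w) := by
      rw [auxDenom_eq_mul_dslope M]; simp [hX]
    rw [auxIntegrand, ← auxDenom, h1]
    by_cases h2 : dslope auxDenom M (X w) = 0
    · simp [hG, h2]
    · simp only [hG]; field_simp
  have hqbound : ∀ q : ℝ, |q| ≤ h → |√2 * q| ≤ 1 / 2 := by
    intro q hq
    rw [abs_mul, abs_of_pos hs0]
    nlinarith
  have hstrip : ∀ w : ℂ, |w.im| ≤ h → |(X w).re - (X w).im - M| ≤ 1 / 2 := by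
    intro w hw
    rw [hXd]
    have := hqbound _ hw
    simp only [diagPoint]
    convert this using 2
    ring
  have hGdiff : DifferentiableOn ℂ G {w | |w.im| ≤ h} := by
    intro w hw
    have hXw : DifferentiableAt ℂ X w := by fun_prop
    have hds : Differentiable ℂ (dslope auxDenom M) := by
      rw [← differentiableOn_univ, differentiableOn_dslope Filter.univ_mem, differentiableOn_univ]
      exact fun x => (hasDerivAt_auxDenom x).differentiableAt
    apply DifferentiableAt.differentiableWithinAt
    refine DifferentiableAt.div (DifferentiableAt.mul ?_ ?_) ?_ (dslope_auxDenom_ne_zero (hstrip w hw))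
    · refine hXw.cpow (differentiableAt_const _) ?_
      rw [hXd]
      apply diagPoint_mem_slitPlane
      have := (abs_le.1 (hqbound _ hw)).1
      linarith
    · exact ((hXw.pow 2).const_mul _).cexp
    · exact (hds _).comp w hXw
  obtain ⟨k, hk⟩ := exists_nat_ge |s.re|
  obtain ⟨C, hC, hbound⟩ := exists_gaussian_bound_auxIntegrand (M + 1 / 2) |s.im| (by positivity) k
  have hlow : ∀ u : ℝ, auxIntegrand s (X (u + (-h : ℝ) * I)) * ω =
      auxIntegrand s (((m + 1 / 2 : ℝ) : ℂ) + ((u - h : ℝ) : ℂ) * ω) * ω := by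
    intro u
    rw [hXd, add_mul_exp_eq_diagPoint]
    congr 3
    · simp [hh, hM]; nlinarith
    · simp; ring_nf
  have hupp : ∀ u : ℝ, auxIntegrand s (X (u + h * I)) * ω =
      auxIntegrand s (((M + 1 / 2 : ℝ) : ℂ) + ((u + h : ℝ) : ℂ) * ω) * ω := by
    intro u
    rw [hXd, add_mul_exp_eq_diagPoint]
    congr 3
    · simp [hh]; nlinarith
    · simp
  have hne : ∀ x : ℝ, ∀ c : ℝ, c ≠ 0 → (x : ℂ) + c * I ≠ 0 := fun x c hc h0 => by
    have := congrArg Complex.im h0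
    simp at this; exact hc this
  have elow : (fun u : ℝ => G (u + (-h : ℝ) * I) / (u + (-h : ℝ) * I)) = fun u : ℝ =>
      auxIntegrand s (((m + 1 / 2 : ℝ) : ℂ) + ((u - h : ℝ) : ℂ) * ω) * ω := by
    ext u; rw [hGw _ (hne u (-h) (by linarith)), hlow]
  have eupp : (fun u : ℝ => G (u + h * I) / (u + h * I)) = fun u : ℝ =>
      auxIntegrand s (((M + 1 / 2 : ℝ) : ℂ) + ((u + h : ℝ) : ℂ) * ω) * ω := by
    ext u; rw [hGw _ (hne u h hh0.ne'), hupp]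
  -- `K₀ = 3` ensures `|y| ≥ 1`, since `y² ≥ (3 - h)²/2` with `h ≤ 1/2`; the Gaussian bound then
  -- holds on intermediate lines, where the denominator might otherwise be small.
  have key := integral_strip_sub_eq_two_pi_I_mul (G := G) (h := h) (K₀ := 3)
    (ε := fun K => C * Real.exp (-((K - h) ^ 2 / 2))) hh0 hGdiff ?_ ?_ ?_ ?_
  · rw [elow, eupp,
      MeasureTheory.integral_sub_right_eq_self (fun u : ℝ =>
        auxIntegrand s (((m + 1 / 2 : ℝ) : ℂ) + (u : ℂ) * ω) * ω),
      MeasureTheory.integral_add_right_eq_self (fun u : ℝ =>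
        auxIntegrand s (((M + 1 / 2 : ℝ) : ℂ) + (u : ℂ) * ω) * ω)] at key
    rw [auxLineIntegral, auxLineIntegral, key]
    -- The sign `e^{πi M²} = (-1)^M` cancels against the same sign in the derivative of the
    -- denominator, leaving exactly `M^{-s} / (2πi)`.
    have hG0 : G 0 = (M : ℂ) ^ (-s) * (-1) ^ M / (2 * Real.pi * I * (-1) ^ M) := by
      simp only [hG, hX, mul_zero, add_zero, dslope_auxDenom_natCast]
      congr 2
      have : (Real.pi : ℂ) * I * (M : ℂ) ^ 2 = (Real.pi : ℂ) * I * (M ^ 2 : ℕ) := by push_cast; ring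
      rw [this, exp_pi_I_mul_natCast]
      rcases Nat.even_or_odd M with he | ho
      · rw [(he.pow_of_ne_zero two_ne_zero).neg_one_pow, he.neg_one_pow]
      · rw [(ho.pow).neg_one_pow, ho.neg_one_pow]
    rw [hG0]
    have : (Real.pi : ℂ) ≠ 0 := by exact_mod_cast Real.pi_ne_zero
    have h1 : ((-1 : ℂ)) ^ M ≠ 0 := pow_ne_zero _ (by norm_num)
    field_simp
  · have h1 : Filter.Tendsto (fun K : ℝ => (K - h) ^ 2 / 2) Filter.atTop Filter.atTop :=
      ((Filter.tendsto_pow_atTop two_ne_zero).comp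
        (Filter.tendsto_atTop_add_const_right _ (-h) Filter.tendsto_id)).atTop_div_const two_pos
    simpa using (Real.tendsto_exp_neg_atTop_nhds_zero.comp h1).const_mul C
  · intro w hw hK
    have hw0 : w ≠ 0 := by
      rintro rfl
      simp at hK
      linarith
    have hh1 : h ≤ 1 / 2 := by nlinarith
    have hsum : |w.re| - h ≤ |w.re + w.im| := by
      have := abs_sub_abs_le_abs_sub w.re (-w.im)
      rw [abs_neg, sub_neg_eq_add] at this
      linarith
    have hyy : (-(√2 / 2) * (w.re + w.im)) ^ 2 = (w.re + w.im) ^ 2 / 2 := half_sqrt_two_mul_sq _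
    have hle : (|w.re| - h) ^ 2 ≤ (w.re + w.im) ^ 2 := by
      rw [← sq_abs (w.re + w.im)]
      have : 0 ≤ |w.re| - h := by linarith
      gcongr
    have hq := abs_le.1 (hqbound _ hw)
    rw [hGw w hw0, norm_mul, norm_exp_neg_three_pi_div_four, mul_one, hXd]
    refine (hbound _ _ s (by linarith [hq.1]) (by linarith [hq.2]) (Or.inl ?_) hk le_rfl).trans ?_
    · rw [← one_le_sq_iff_one_le_abs, hyy]
      nlinarith
    · rw [hyy]
      gcongr
  · rw [elow]
    exact (integrable_auxIntegrand_line m s).comp_sub_right h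
  · rw [eupp]
    exact (integrable_auxIntegrand_line M s).comp_add_right h

/-- The approximate functional equation with its remainder as an integral. -/
theorem riemannAux_eq_sum_add_auxLineIntegral (N : ℕ) (s : ℂ) :
    riemannAux s = ∑ n ∈ Finset.range N, ((n + 1 : ℕ) : ℂ) ^ (-s) + auxLineIntegral (N + 1 / 2) s := by
  induction N with
  | zero => simp [riemannAux_eq_auxLineIntegral]
  | succ m ih =>
    rw [ih, Finset.sum_range_succ, ← auxLineIntegral_sub_auxLineIntegral m s]
    ring

/-! ### Growth of the auxiliary function, and its size far to the right. -/

/-- A half-integer close to the saddle point `√(t / 2π)`. -/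
theorem exists_nat_near_saddle {t : ℝ} (ht : 7 ≤ t) :
    ∃ N : ℕ, 1 ≤ N ∧ (N : ℝ) ≤ t ∧
      |t - 2 * Real.pi * ((N : ℝ) + 1 / 2) ^ 2| ≤ 4 * Real.pi * ((N : ℝ) + 1 / 2) := by
  have hpi := Real.pi_gt_three
  have hpi2 := Real.pi_lt_d2
  set η := √(t / (2 * Real.pi)) with hη
  have hη2 : η ^ 2 = t / (2 * Real.pi) := Real.sq_sqrt (by positivity)
  have ht2 : t = 2 * Real.pi * η ^ 2 := by rw [hη2]; field_simp
  -- This is where `7 > 2π` is used. With `N = ⌊η⌋` the half-integer `a = N + 1/2` satisfies `|η -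
  -- a| ≤ 1/2`, hence `|η² - a²| ≤ a + 1/4 ≤ 2a`.
  have hη1 : 1 ≤ η := by
    rw [hη, Real.one_le_sqrt, le_div_iff₀ (by positivity)]; linarith
  have h1 := Nat.floor_le (zero_le_one.trans hη1)
  have h2 := Nat.lt_floor_add_one η
  refine ⟨⌊η⌋₊, Nat.le_floor (by simpa using hη1), ?_, ?_⟩
  · nlinarith
  · set a : ℝ := (⌊η⌋₊ : ℝ) + 1 / 2 with ha
    have h3 : t - 2 * Real.pi * a ^ 2 = 2 * Real.pi * (η ^ 2 - a ^ 2) := by rw [ht2]; ring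
    rw [h3, abs_mul, abs_of_pos (by positivity : 0 < 2 * Real.pi)]
    have h4 : |η ^ 2 - a ^ 2| ≤ 2 * a := by
      rw [abs_le]; constructor <;> nlinarith
    nlinarith

/-- Near the saddle point the growth of `e^{t arg x}` is offset by `e^{πi x²}`, so the exponential
factor no longer depends on `s` or `N`; only the power of `‖x‖` does. -/
theorem norm_auxIntegrand_le_of_saddle {N : ℕ} {s : ℂ} (ht : 0 ≤ s.im)
    (hN : |s.im - 2 * Real.pi * ((N : ℝ) + 1 / 2) ^ 2| ≤ 4 * Real.pi * ((N : ℝ) + 1 / 2)) (y : ℝ) :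
    ‖auxIntegrand s (diagPoint (N + 1 / 2) y)‖ ≤ ‖diagPoint (N + 1 / 2) y‖ ^ (-s.re) *
      Real.exp (4 * Real.pi * |y| - Real.pi * y ^ 2) := by
  refine (norm_auxIntegrand_diagPoint_le (by positivity) (Or.inr ⟨N, rfl⟩) s).trans ?_
  exact mul_le_mul_of_nonneg_left (Real.exp_le_exp.2 (mul_arg_diagPoint_le (by simp) ht hN y))
    (by positivity)

/-- From `N = 1` on, the distance of the line to the origin is at least `3 / (2√2) > 1.06`. A bound
strictly above `1` turns `‖x‖^{-σ}` into exponential decay in `σ`. -/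
theorem twentyOne_div_twenty_le_norm {N : ℕ} (hN : 1 ≤ N) (y : ℝ) :
    21 / 20 ≤ ‖diagPoint (N + 1 / 2) y‖ := by
  have : (1 : ℝ) ≤ N := by exact_mod_cast hN
  exact norm_diagPoint_ge (by nlinarith)

theorem norm_natCast_cpow_neg (n : ℕ) (s : ℂ) :
    ‖((n + 1 : ℕ) : ℂ) ^ (-s)‖ = ((n : ℝ) + 1) ^ (-s.re) := by
  rw [Complex.norm_natCast_cpow_of_pos n.succ_pos]
  simp

/-- Polynomial growth of the auxiliary function in vertical strips. -/
theorem exists_norm_riemannAux_le (k : ℕ) :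
    ∃ C : ℝ, 1 ≤ C ∧ ∀ s : ℂ, -(k : ℝ) ≤ s.re → 7 ≤ s.im → ‖riemannAux s‖ ≤ C * s.im ^ (k + 1) := by
  obtain ⟨C, hC, hb⟩ := pow_mul_exp_le_gaussian 1 (4 * Real.pi) zero_le_one k
  refine ⟨1 + C * 2 ^ k * √(2 * Real.pi), by simp; positivity, fun s hs ht => ?_⟩
  obtain ⟨N, hN1, hNt, hN⟩ := exists_nat_near_saddle ht
  have hN1' : (1 : ℝ) ≤ N := by exact_mod_cast hN1
  have hline : ‖auxLineIntegral (N + 1 / 2) s‖ ≤ C * (2 * N) ^ k * √(2 * Real.pi) := by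
    apply norm_auxLineIntegral_le
    intro y
    refine (norm_auxIntegrand_le_of_saddle (by linarith) hN y).trans ?_
    have h1 : 1 ≤ ‖diagPoint (N + 1 / 2) y‖ := by linarith [twentyOne_div_twenty_le_norm hN1 y]
    -- Separating `N` from `y` multiplicatively lets the Gaussian constant `C` be chosen before `s`.
    have h2 : ‖diagPoint (N + 1 / 2) y‖ ≤ 2 * N * (1 + 2 * |y|) := by
      have := norm_diagPoint_le (a := N + 1 / 2) (by positivity) y
      nlinarith [abs_nonneg y]
    have h3 : ‖diagPoint (N + 1 / 2) y‖ ^ (-s.re) ≤ (2 * N * (1 + 2 * |y|)) ^ k := by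
      calc _ ≤ ‖diagPoint (N + 1 / 2) y‖ ^ (k : ℝ) :=
            Real.rpow_le_rpow_of_exponent_le h1 (by linarith)
        _ = ‖diagPoint (N + 1 / 2) y‖ ^ k := Real.rpow_natCast _ _
        _ ≤ _ := by gcongr
    calc _ ≤ (2 * N * (1 + 2 * |y|)) ^ k * Real.exp (4 * Real.pi * |y| - Real.pi * y ^ 2) := by
          gcongr
      _ = (2 * N) ^ k * ((1 + 2 * |y|) ^ k * Real.exp (4 * Real.pi * |y| - Real.pi * y ^ 2)) := by
          rw [mul_pow]; ring
      _ ≤ (2 * N) ^ k * (C * Real.exp (-y ^ 2)) :=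
          mul_le_mul_of_nonneg_left (hb y) (by positivity)
      _ = _ := by ring
  have hsum : ‖∑ n ∈ Finset.range N, ((n + 1 : ℕ) : ℂ) ^ (-s)‖ ≤ N * N ^ k := by
    refine (norm_sum_le_of_le (Finset.range N) (f := fun n : ℕ => ((n + 1 : ℕ) : ℂ) ^ (-s))
      (n := fun _ => (N : ℝ) ^ k) fun n hn => ?_).trans ?_
    · rw [norm_natCast_cpow_neg]
      have hn1 : (n : ℝ) + 1 ≤ N := by exact_mod_cast Finset.mem_range.1 hn
      calc _ ≤ ((n : ℝ) + 1) ^ (k : ℝ) :=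
            Real.rpow_le_rpow_of_exponent_le (by simp) (by linarith)
        _ = ((n : ℝ) + 1) ^ k := Real.rpow_natCast _ _
        _ ≤ _ := by gcongr
    · simp
  rw [riemannAux_eq_sum_add_auxLineIntegral N s]
  calc _ ≤ (N : ℝ) * N ^ k + C * (2 * N) ^ k * √(2 * Real.pi) :=
        (norm_add_le _ _).trans (add_le_add hsum hline)
    _ ≤ s.im * s.im ^ k + C * (2 * s.im) ^ k * √(2 * Real.pi) := by gcongr
    _ = s.im ^ (k + 1) + C * 2 ^ k * √(2 * Real.pi) * s.im ^ k := by rw [mul_pow]; ring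
    _ ≤ s.im ^ (k + 1) + C * 2 ^ k * √(2 * Real.pi) * s.im ^ (k + 1) := by
        gcongr
        · linarith
        · simp
    _ = _ := by ring

theorem norm_auxLineIntegral_le_of_le_re {N : ℕ} {s : ℂ} {C c : ℝ} (hN1 : 1 ≤ N) (hs : 0 ≤ s.re)
    (hC : ∀ y : ℝ, (1 + 2 * |y|) ^ 0 * Real.exp (c * |y| - Real.pi * y ^ 2) ≤ C * Real.exp (-y ^ 2))
    {E : ℝ} (hE : 0 ≤ E)
    (h : ∀ y : ℝ, ‖auxIntegrand s (diagPoint (N + 1 / 2) y)‖ ≤ ‖diagPoint (N + 1 / 2) y‖ ^ (-s.re) *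
      (E * Real.exp (c * |y| - Real.pi * y ^ 2))) :
    ‖auxLineIntegral (N + 1 / 2) s‖ ≤ E * C * √(2 * Real.pi) * (21 / 20) ^ (-s.re) := by
  have := norm_auxLineIntegral_le (a := N + 1 / 2) (s := s) (C := E * C * (21 / 20) ^ (-s.re))
    fun y => ?_
  · linarith
  · refine (h y).trans ?_
    have h1 : ‖diagPoint (N + 1 / 2) y‖ ^ (-s.re) ≤ (21 / 20 : ℝ) ^ (-s.re) :=
      Real.rpow_le_rpow_of_nonpos (by norm_num) (twentyOne_div_twenty_le_norm hN1 y) (by linarith)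
    have h2 := hC y
    rw [pow_zero, one_mul] at h2
    calc _ ≤ (21 / 20 : ℝ) ^ (-s.re) * (E * (C * Real.exp (-y ^ 2))) := by gcongr
      _ = _ := by ring

/-- Far to the right the auxiliary function is exponentially close to `1`, uniformly in the upper
half plane. -/
theorem exists_norm_riemannAux_sub_one_le :
    ∃ C : ℝ, 0 ≤ C ∧ ∀ s : ℂ, 2 ≤ s.re → 7 ≤ s.im →
      ‖riemannAux s - 1‖ ≤ C * (21 / 20 : ℝ) ^ (-s.re) := by
  obtain ⟨C, hC, hb⟩ := pow_mul_exp_le_gaussian 1 (4 * Real.pi) zero_le_one 0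
  have hsm : Summable fun n : ℕ => (((n : ℝ) + 2) ^ 2)⁻¹ := by
    have := (summable_nat_add_iff 2).2 (Real.summable_nat_pow_inv.2 one_lt_two)
    simpa using this
  set D := ∑' n : ℕ, (((n : ℝ) + 2) ^ 2)⁻¹ with hD
  refine ⟨D * (21 / 20) ^ 2 + 1 * C * √(2 * Real.pi), by positivity, fun s hs ht => ?_⟩
  obtain ⟨N, hN1, -, hN⟩ := exists_nat_near_saddle ht
  have hline := norm_auxLineIntegral_le_of_le_re hN1 (by linarith) hb zero_le_one fun y => by
    rw [one_mul]; exact norm_auxIntegrand_le_of_saddle (by linarith) hN y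
  obtain ⟨M, rfl⟩ : ∃ M, N = M + 1 := ⟨N - 1, by omega⟩
  rw [riemannAux_eq_sum_add_auxLineIntegral (M + 1) s, Finset.sum_range_succ']
  have hsum : ‖∑ n ∈ Finset.range M, ((n + 1 + 1 : ℕ) : ℂ) ^ (-s)‖ ≤
      D * (21 / 20) ^ 2 * (21 / 20) ^ (-s.re) := by
    refine (norm_sum_le_of_le (Finset.range M) (f := fun n : ℕ => ((n + 1 + 1 : ℕ) : ℂ) ^ (-s))
      (n := fun n => (((n : ℝ) + 2) ^ 2)⁻¹ * ((21 / 20) ^ 2 * (21 / 20) ^ (-s.re))) fun n _ => ?_).trans ?_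
    · rw [norm_natCast_cpow_neg]
      push_cast
      have h0 : (0 : ℝ) < n + 2 := by positivity
      -- Each term with base at least `2` is split as `n^{-2} · n^{-(σ - 2)}`: the first factor is
      -- summable, the second at most `(21/20)^{-(σ - 2)}`.
      rw [show (n : ℝ) + 1 + 1 = n + 2 by ring,
        show -s.re = -2 + -(s.re - 2) by ring, Real.rpow_add h0, Real.rpow_add (by norm_num)]
      have h1 : ((n : ℝ) + 2) ^ (-(2 : ℝ)) = (((n : ℝ) + 2) ^ 2)⁻¹ := by
        rw [Real.rpow_neg h0.le]; norm_cast
      have h2 : (21 / 20 : ℝ) ^ (-(2 : ℝ)) = ((21 / 20 : ℝ) ^ 2)⁻¹ := by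
        rw [Real.rpow_neg (by norm_num)]; norm_cast
      rw [h1, h2, mul_inv_cancel_left₀ (by norm_num)]
      refine mul_le_mul_of_nonneg_left ?_ (by positivity)
      apply Real.rpow_le_rpow_of_nonpos (by norm_num) _ (by linarith)
      have : (0 : ℝ) ≤ n := n.cast_nonneg
      linarith
    · rw [← Finset.sum_mul, mul_assoc]
      gcongr
      exact hsm.sum_le_tsum _ fun n _ => by positivity
  have h1 : ((0 + 1 : ℕ) : ℂ) ^ (-s) = 1 := by simp
  rw [h1]
  calc _ = ‖∑ n ∈ Finset.range M, ((n + 1 + 1 : ℕ) : ℂ) ^ (-s) +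
        auxLineIntegral ((M + 1 : ℕ) + 1 / 2) s‖ := by congr 1; ring
    _ ≤ _ := (norm_add_le _ _).trans (add_le_add hsum hline)
    _ = _ := by ring

theorem tendsto_const_mul_rpow_neg (C : ℝ) :
    Filter.Tendsto (fun x : ℝ => C * (21 / 20 : ℝ) ^ (-x)) Filter.atTop (nhds 0) := by
  have h := tendsto_rpow_atTop_of_base_lt_one (20 / 21 : ℝ) (by norm_num) (by norm_num)
  have h2 : (fun x : ℝ => C * (21 / 20 : ℝ) ^ (-x)) = fun x : ℝ => C * (20 / 21 : ℝ) ^ x := by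
    ext x
    rw [Real.rpow_neg (by norm_num), ← Real.inv_rpow (by norm_num)]
    norm_num
  rw [h2]
  simpa using h.const_mul C

/-- The zeros with bounded nonnegative ordinate have bounded abscissa. -/
theorem exists_riemannAux_ne_zero_of_im_mem (T : ℝ) :
    ∃ b : ℝ, ∀ s : ℂ, b ≤ s.re → 0 ≤ s.im → s.im ≤ T → riemannAux s ≠ 0 := by
  -- For bounded `t` no saddle point is needed: the fixed line through `3/2` serves, `3π` is `2π ·
  -- 3/2`, and `t arg x` is bounded crudely by `Tπ`.
  obtain ⟨C, hC, hb⟩ := pow_mul_exp_le_gaussian 1 (3 * Real.pi) zero_le_one 0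
  set E := Real.exp (T * Real.pi)
  have hlim := tendsto_const_mul_rpow_neg (E * C * √(2 * Real.pi))
  obtain ⟨b, hb1⟩ := Filter.eventually_atTop.1 (hlim.eventually (gt_mem_nhds one_pos))
  refine ⟨max b 0, fun s hs h0 hT => ?_⟩
  have hline : ‖auxLineIntegral ((1 : ℕ) + 1 / 2) s‖ ≤
      E * C * √(2 * Real.pi) * (21 / 20) ^ (-s.re) := by
    refine norm_auxLineIntegral_le_of_le_re le_rfl ((le_max_right _ _).trans hs) hb
      (Real.exp_pos _).le fun y => ?_
    refine (norm_auxIntegrand_diagPoint_le (by positivity) (Or.inr ⟨1, rfl⟩) s).trans ?_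
    rw [← Real.exp_add]
    have hpi := Real.pi_pos
    have h1 : s.im * (diagPoint ((1 : ℕ) + 1 / 2) y).arg ≤ T * Real.pi :=
      (mul_le_mul_of_nonneg_left (Complex.arg_le_pi _) h0).trans (by gcongr)
    have h2 : -y ≤ |y| := neg_le_abs y
    refine mul_le_mul_of_nonneg_left (Real.exp_le_exp.2 ?_) (by positivity)
    push_cast
    nlinarith [mul_nonneg hpi.le (sq_nonneg y)]
  have hlt := hline.trans_lt (hb1 s.re ((le_max_left _ _).trans hs))
  intro h
  rw [riemannAux_eq_sum_add_auxLineIntegral 1 s] at h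
  simp only [Finset.range_one, Finset.sum_singleton, zero_add, Nat.cast_one, Complex.one_cpow] at h
  rw [Nat.cast_one] at hlt
  rw [eq_neg_of_add_eq_zero_right h, norm_neg, norm_one] at hlt
  exact lt_irrefl _ hlt

/-! ### Littlewood's lemma on a zero-free rectangle. -/

/-- The integral of `(x - σ) log |f(x + it)|` over a horizontal segment. -/
noncomputable def weightedLogIntegral (f : ℂ → ℂ) (σ b t : ℝ) : ℝ :=
  ∫ x in σ..b, (x - σ) * Real.log ‖f (x + t * Complex.I)‖

/-- Writing `log |γ|` as half the logarithm of `re² + im²` avoids any branch of the complex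
logarithm. -/
theorem HasDerivAt.log_norm_complex {γ : ℝ → ℂ} {γ' : ℂ} {t : ℝ} (h : HasDerivAt γ γ' t)
    (h0 : γ t ≠ 0) : HasDerivAt (fun t => Real.log ‖γ t‖) (γ' / γ t).re t := by
  have h1 : HasDerivAt (fun t => (γ t).re) γ'.re t :=
    Complex.reCLM.hasFDerivAt.comp_hasDerivAt t h
  have h2 : HasDerivAt (fun t => (γ t).im) γ'.im t :=
    Complex.imCLM.hasFDerivAt.comp_hasDerivAt t h
  have hN : Complex.normSq (γ t) ≠ 0 := by simpa using h0
  have h3 : HasDerivAt (fun t => (γ t).re * (γ t).re + (γ t).im * (γ t).im)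
      (γ'.re * (γ t).re + (γ t).re * γ'.re + (γ'.im * (γ t).im + (γ t).im * γ'.im)) t :=
    (h1.mul h1).add (h2.mul h2)
  have h4 := (h3.log (by rwa [Complex.normSq_apply] at hN)).div_const 2
  have e : (fun t => Real.log ‖γ t‖) =
      fun t => Real.log ((γ t).re * (γ t).re + (γ t).im * (γ t).im) / 2 := by
    ext t
    rw [← Complex.normSq_apply, Complex.normSq_eq_norm_sq, Real.log_pow]
    push_cast
    ring
  rw [e]
  refine h4.congr_deriv ?_
  rw [Complex.div_re, Complex.normSq_apply]
  rw [Complex.normSq_apply] at hN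
  field_simp
  ring

open Complex in
theorem hasDerivAt_vertical (x t : ℝ) : HasDerivAt (fun t : ℝ => (x : ℂ) + t * I) I t := by
  simpa using ((Complex.ofRealCLM.hasDerivAt (x := t)).mul_const I).const_add (x : ℂ)

open Complex in
theorem hasDerivAt_horizontal (x t : ℝ) : HasDerivAt (fun x : ℝ => (x : ℂ) + t * I) 1 x := by
  simpa using (Complex.ofRealCLM.hasDerivAt (x := x)).add_const ((t : ℂ) * I)

open Complex in
theorem hasDerivAt_log_norm_vertical {g : ℂ → ℂ} {x t : ℝ} (hg : DifferentiableAt ℂ g (x + t * I))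
    (h0 : g (x + t * I) ≠ 0) :
    HasDerivAt (fun t : ℝ => Real.log ‖g (x + t * I)‖) (-(logDeriv g (x + t * I)).im) t := by
  have h1 : HasDerivAt (fun t : ℝ => g (x + t * I)) (deriv g (x + t * I) * I) t :=
    HasDerivAt.comp t hg.hasDerivAt (hasDerivAt_vertical x t)
  refine (h1.log_norm_complex h0).congr_deriv ?_
  rw [logDeriv_apply, mul_div_right_comm]
  simp

open Complex in
theorem hasDerivAt_log_norm_horizontal {g : ℂ → ℂ} {x t : ℝ}
    (hg : DifferentiableAt ℂ g (x + t * I)) (h0 : g (x + t * I) ≠ 0) :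
    HasDerivAt (fun x : ℝ => Real.log ‖g (x + t * I)‖) (logDeriv g (x + t * I)).re x := by
  have h1 : HasDerivAt (fun x : ℝ => g (x + t * I)) (deriv g (x + t * I) * 1) x :=
    HasDerivAt.comp x hg.hasDerivAt (hasDerivAt_horizontal x t)
  refine (h1.log_norm_complex h0).congr_deriv ?_
  rw [logDeriv_apply, mul_one]

open Complex in
theorem hasDerivAt_im_vertical {h : ℂ → ℂ} {x t : ℝ} (hh : DifferentiableAt ℂ h (x + t * I)) :
    HasDerivAt (fun t : ℝ => (h (x + t * I)).im) (deriv h (x + t * I)).re t := by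
  have h1 : HasDerivAt (fun t : ℝ => h (x + t * I)) (deriv h (x + t * I) * I) t :=
    HasDerivAt.comp t hh.hasDerivAt (hasDerivAt_vertical x t)
  have h2 : HasDerivAt (fun t : ℝ => (h (x + t * I)).im) (deriv h (x + t * I) * I).im t :=
    Complex.imCLM.hasFDerivAt.comp_hasDerivAt t h1
  simpa using h2

open Complex in
theorem hasDerivAt_re_horizontal {h : ℂ → ℂ} {x t : ℝ} (hh : DifferentiableAt ℂ h (x + t * I)) :
    HasDerivAt (fun x : ℝ => (h (x + t * I)).re) (deriv h (x + t * I)).re x := by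
  have h1 : HasDerivAt (fun x : ℝ => h (x + t * I)) (deriv h (x + t * I) * 1) x :=
    HasDerivAt.comp x hh.hasDerivAt (hasDerivAt_horizontal x t)
  have h2 : HasDerivAt (fun x : ℝ => (h (x + t * I)).re) (deriv h (x + t * I) * 1).re x :=
    Complex.reCLM.hasFDerivAt.comp_hasDerivAt x h1
  simpa using h2

section

open Complex Set MeasureTheory intervalIntegral

variable {g : ℂ → ℂ} {σ b t₁ T : ℝ}

theorem continuousOn_uncurry_rect {h : ℂ → ℂ}
    (hh : ContinuousOn h (Icc σ b ×ℂ Icc t₁ T)) :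
    ContinuousOn (fun p : ℝ × ℝ => h (p.1 + p.2 * I)) (Icc σ b ×ˢ Icc t₁ T) := by
  refine hh.comp (by fun_prop) fun p hp => ?_
  simpa [mem_reProdIm] using And.intro hp.1 hp.2

/-- Interchanging a difference in the vertical direction with a weighted integral in the horizontal
direction. -/
theorem integral_weight_sub_eq {F F' : ℝ → ℝ → ℝ} (hσb : σ ≤ b)
    (hF : ∀ x ∈ Icc σ b, ∀ t ∈ Icc t₁ T, HasDerivAt (F x) (F' x t) t)
    (hFc : ∀ t ∈ Icc t₁ T, ContinuousOn (fun x => F x t) (Icc σ b))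
    (hF' : ContinuousOn (fun p : ℝ × ℝ => F' p.1 p.2) (Icc σ b ×ˢ Icc t₁ T))
    {t' t : ℝ} (ht' : t' ∈ Icc t₁ T) (ht : t ∈ Icc t₁ T) :
    (∫ x in σ..b, (x - σ) * F x t) - (∫ x in σ..b, (x - σ) * F x t') =
      ∫ τ in t'..t, ∫ x in σ..b, (x - σ) * F' x τ := by
  have hsub : uIcc t' t ⊆ Icc t₁ T := uIcc_subset_Icc ht' ht
  have hint : ∀ t ∈ Icc t₁ T, IntervalIntegrable (fun x => (x - σ) * F x t) volume σ b := by
    intro t ht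
    apply ContinuousOn.intervalIntegrable
    rw [uIcc_of_le hσb]
    exact ContinuousOn.mul (by fun_prop) (hFc t ht)
  rw [← integral_sub (hint t ht) (hint t' ht'), intervalIntegral_intervalIntegral_swap]
  · apply integral_congr
    intro x hx
    rw [uIcc_of_le hσb] at hx
    simp only
    rw [intervalIntegral.integral_const_mul, integral_eq_sub_of_hasDerivAt
      (fun τ hτ => hF x hx τ (hsub hτ)), mul_sub]
    apply ContinuousOn.intervalIntegrable
    exact (hF'.comp (f := fun τ => (x, τ)) (by fun_prop) fun τ hτ => ⟨hx, hsub hτ⟩)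
  · have hc : ContinuousOn (Function.uncurry fun τ x => (x - σ) * F' x τ)
        (uIcc t' t ×ˢ uIcc σ b) := by
      apply ContinuousOn.mul
      · fun_prop
      · refine hF'.comp (f := fun p : ℝ × ℝ => (p.2, p.1)) (by fun_prop) fun p hp => ?_
        rw [uIcc_of_le hσb] at hp
        exact ⟨hp.2, hsub hp.1⟩
    exact (hc.integrableOn_compact (isCompact_uIcc.prod isCompact_uIcc)).mono_set
      (prod_mono uIoc_subset_uIcc uIoc_subset_uIcc)

theorem mem_rect {x t : ℝ} (hx : x ∈ Icc σ b) (ht : t ∈ Icc t₁ T) :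
    (x : ℂ) + t * I ∈ Icc σ b ×ℂ Icc t₁ T := by
  simpa [mem_reProdIm] using ⟨hx, ht⟩

theorem AnalyticOnNhd.logDeriv {S : Set ℂ} (hg : AnalyticOnNhd ℂ g S) (h0 : ∀ s ∈ S, g s ≠ 0) :
    AnalyticOnNhd ℂ (logDeriv g) S := fun s hs => (hg.deriv s hs).div (hg s hs) (h0 s hs)

/-- The vertical derivative of `log |g|` is `-Im (g'/g)`; the rest is Fubini. -/
theorem weightedLogIntegral_sub_of_ne_zero
    (hg : AnalyticOnNhd ℂ g (Icc σ b ×ℂ Icc t₁ T))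
    (h0 : ∀ s ∈ Icc σ b ×ℂ Icc t₁ T, g s ≠ 0) (hσb : σ ≤ b) {t' t : ℝ} (ht' : t' ∈ Icc t₁ T)
    (ht : t ∈ Icc t₁ T) :
    weightedLogIntegral g σ b t - weightedLogIntegral g σ b t' =
      ∫ τ in t'..t, ∫ x in σ..b, (x - σ) * -(_root_.logDeriv g (x + τ * I)).im := by
  have hl := hg.logDeriv h0
  refine integral_weight_sub_eq (F := fun x t => Real.log ‖g (x + t * I)‖)
    (F' := fun x t => -(_root_.logDeriv g (x + t * I)).im) hσb ?_ ?_ ?_ ht' ht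
  · exact fun x hx t ht => hasDerivAt_log_norm_vertical (hg _ (mem_rect hx ht)).differentiableAt
      (h0 _ (mem_rect hx ht))
  · exact fun t ht x hx => (hasDerivAt_log_norm_horizontal (hg _ (mem_rect hx ht)).differentiableAt
      (h0 _ (mem_rect hx ht))).continuousAt.continuousWithinAt
  · exact (continuous_im.comp_continuousOn (continuousOn_uncurry_rect hl.continuousOn)).neg

/-- By Cauchy-Riemann, `∂_t (-Im (g'/g)) = -∂_x Re (g'/g)`. Integrating by parts against `x - σ`
leaves a boundary term at `b` and `∫ Re (g'/g) dx`, a difference of values of `log |g|`. -/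
theorem integral_weight_im_logDeriv_sub
    (hg : AnalyticOnNhd ℂ g (Icc σ b ×ℂ Icc t₁ T))
    (h0 : ∀ s ∈ Icc σ b ×ℂ Icc t₁ T, g s ≠ 0) (hσb : σ ≤ b) {t' t : ℝ} (ht' : t' ∈ Icc t₁ T)
    (ht : t ∈ Icc t₁ T) :
    (∫ x in σ..b, (x - σ) * -(_root_.logDeriv g (x + t * I)).im) -
        (∫ x in σ..b, (x - σ) * -(_root_.logDeriv g (x + t' * I)).im) =
      ∫ τ in t'..t, (Real.log ‖g (b + τ * I)‖ - Real.log ‖g (σ + τ * I)‖ -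
        (b - σ) * (_root_.logDeriv g (b + τ * I)).re) := by
  have hl := hg.logDeriv h0
  have hsub : uIcc t' t ⊆ Icc t₁ T := uIcc_subset_Icc ht' ht
  rw [integral_weight_sub_eq (F := fun x t => -(_root_.logDeriv g (x + t * I)).im)
    (F' := fun x t => -(deriv (_root_.logDeriv g) (x + t * I)).re) hσb ?_ ?_ ?_ ht' ht]
  · apply integral_congr
    intro τ hτ
    have hτ' := hsub hτ
    have hi1 : IntervalIntegrable (fun x : ℝ => -(deriv (_root_.logDeriv g) (x + τ * I)).re)
        volume σ b := by
      apply ContinuousOn.intervalIntegrable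
      rw [uIcc_of_le hσb]
      exact (continuous_re.comp_continuousOn (hl.deriv.continuousOn.comp (by fun_prop)
        fun x hx => mem_rect hx hτ')).neg
    have hi2 : IntervalIntegrable (fun x : ℝ => (_root_.logDeriv g (x + τ * I)).re)
        volume σ b := by
      apply ContinuousOn.intervalIntegrable
      rw [uIcc_of_le hσb]
      exact continuous_re.comp_continuousOn (hl.continuousOn.comp (by fun_prop)
        fun x hx => mem_rect hx hτ')
    simp only
    rw [integral_mul_deriv_eq_deriv_mul (u' := fun _ => 1)
      (v := fun x : ℝ => -(_root_.logDeriv g (x + τ * I)).re)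
      (u := fun x => x - σ) (fun x _ => (hasDerivAt_id x).sub_const σ)
      (fun x hx => (hasDerivAt_re_horizontal (hl _ (mem_rect (by rwa [uIcc_of_le hσb] at hx)
        hτ')).differentiableAt).neg) (by simp) hi1]
    have e : (∫ x in σ..b, (_root_.logDeriv g (x + τ * I)).re) =
        Real.log ‖g (b + τ * I)‖ - Real.log ‖g (σ + τ * I)‖ :=
      integral_eq_sub_of_hasDerivAt (fun x hx => by
        rw [uIcc_of_le hσb] at hx
        exact hasDerivAt_log_norm_horizontal (hg _ (mem_rect hx hτ')).differentiableAt
          (h0 _ (mem_rect hx hτ'))) hi2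
    simp only [one_mul, intervalIntegral.integral_neg, e]
    ring
  · exact fun x hx t ht => (hasDerivAt_im_vertical (hl _ (mem_rect hx ht)).differentiableAt).neg
  · exact fun t ht => (continuous_im.comp_continuousOn (hl.continuousOn.comp (by fun_prop)
        fun x hx => mem_rect hx ht)).neg
  · exact (continuous_re.comp_continuousOn (continuousOn_uncurry_rect hl.deriv.continuousOn)).neg

end

/-! ### The contribution of a single zero. -/

section

open Complex Set MeasureTheory intervalIntegral Filter Topology

/-- The density of the continuous part of the derivative of the weighted logarithmic integral of the
identity function. -/
noncomputable def logDensity (p q τ : ℝ) : ℝ :=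
  Real.log ‖(q : ℂ) + τ * I‖ - Real.log ‖(p : ℂ) + τ * I‖ - (q - p) * (1 / ((q : ℂ) + τ * I)).re

theorem ofReal_add_mul_I_ne_zero_of_re {x : ℝ} (hx : x ≠ 0) (t : ℝ) : (x : ℂ) + t * I ≠ 0 :=
  fun h => hx (by simpa using congrArg re h)

theorem ofReal_add_mul_I_ne_zero_of_im (x : ℝ) {t : ℝ} (ht : t ≠ 0) : (x : ℂ) + t * I ≠ 0 :=
  fun h => ht (by simpa using congrArg im h)

theorem intervalIntegrable_log_norm_vertical {f : ℂ → ℂ} (hf : Differentiable ℂ f) (x t t' : ℝ) :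
    IntervalIntegrable (fun τ : ℝ => Real.log ‖f (x + τ * I)‖) volume t t' := by
  apply MeromorphicOn.intervalIntegrable_log_norm (f := fun τ : ℝ => f (x + τ * I))
  intro τ _
  apply AnalyticAt.meromorphicAt
  have h1 : AnalyticAt ℝ f (x + τ * I) := (hf.analyticAt _).restrictScalars
  have h2 : AnalyticAt ℝ (fun τ : ℝ => (x : ℂ) + τ * I) τ :=
    analyticAt_const.add ((Complex.ofRealCLM.analyticAt τ).mul analyticAt_const)
  exact h1.comp_of_eq h2 rfl

theorem intervalIntegrable_log_norm_horizontal {f : ℂ → ℂ} (hf : Differentiable ℂ f) (t x x' : ℝ) :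
    IntervalIntegrable (fun x : ℝ => Real.log ‖f (x + t * I)‖) volume x x' := by
  apply MeromorphicOn.intervalIntegrable_log_norm (f := fun x : ℝ => f (x + t * I))
  intro x _
  apply AnalyticAt.meromorphicAt
  have h1 : AnalyticAt ℝ f (x + t * I) := (hf.analyticAt _).restrictScalars
  have h2 : AnalyticAt ℝ (fun x : ℝ => (x : ℂ) + t * I) x :=
    (Complex.ofRealCLM.analyticAt x).add analyticAt_const
  exact h1.comp_of_eq h2 rfl

theorem intervalIntegrable_weighted_log_norm {f : ℂ → ℂ} (hf : Differentiable ℂ f) (σ b t : ℝ) :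
    IntervalIntegrable (fun x : ℝ => (x - σ) * Real.log ‖f (x + t * I)‖) volume σ b :=
  (intervalIntegrable_log_norm_horizontal hf t σ b).continuousOn_mul (by fun_prop)

theorem intervalIntegrable_logDensity {p q : ℝ} (hq : 0 < q) (t t' : ℝ) :
    IntervalIntegrable (logDensity p q) volume t t' := by
  have h := intervalIntegrable_log_norm_vertical differentiable_id
  refine ((h q t t').sub (h p t t')).sub (Continuous.intervalIntegrable ?_ _ _)
  refine continuous_const.mul (continuous_re.comp (Continuous.div continuous_const (by fun_prop) ?_))
  exact ofReal_add_mul_I_ne_zero_of_re hq.ne'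

theorem norm_ofReal_add_neg_mul_I (x t : ℝ) : ‖(x : ℂ) + (-t : ℝ) * I‖ = ‖(x : ℂ) + t * I‖ := by
  rw [← Complex.norm_conj]; simp

theorem logDensity_neg (p q τ : ℝ) : logDensity p q (-τ) = logDensity p q τ := by
  have h : ∀ w : ℂ, (1 / w).re = w.re / normSq w := fun w => by simp [inv_re]
  simp only [logDensity, norm_ofReal_add_neg_mul_I, h, normSq_eq_norm_sq]
  simp

theorem integral_weight_div_sq_add_sq (p q : ℝ) {τ : ℝ} (hτ : 0 < τ) :
    ∫ x in p..q, (x - p) * -(logDeriv (fun s : ℂ => s) (x + τ * I)).im =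
      τ * (Real.log ‖(q : ℂ) + τ * I‖ - Real.log ‖(p : ℂ) + τ * I‖) -
        p * (Real.arctan (q / τ) - Real.arctan (p / τ)) := by
  have e : ∀ x : ℝ, (x - p) * -(logDeriv (fun s : ℂ => s) (x + τ * I)).im =
      τ * (x / (x ^ 2 + τ ^ 2)) - p * (τ / (x ^ 2 + τ ^ 2)) := by
    intro x
    rw [logDeriv_id', one_div, inv_im, normSq_apply]
    simp
    have : x ^ 2 + τ ^ 2 ≠ 0 := by positivity
    have : x * x + τ * τ ≠ 0 := by nlinarith [mul_pos hτ hτ, mul_self_nonneg x]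
    field_simp
  simp_rw [e]
  rw [integral_eq_sub_of_hasDerivAt (f := fun x : ℝ => τ * Real.log ‖(x : ℂ) + τ * I‖ -
    p * Real.arctan (x / τ))]
  · ring
  · intro x _
    have h1 := hasDerivAt_log_norm_horizontal (g := fun s : ℂ => s) (x := x) (t := τ)
      differentiableAt_id (ofReal_add_mul_I_ne_zero_of_im x hτ.ne')
    have h2 : HasDerivAt (fun x : ℝ => Real.arctan (x / τ)) (1 / (1 + (x / τ) ^ 2) * (1 / τ)) x :=
      ((hasDerivAt_id x).div_const τ).arctan
    refine ((h1.const_mul τ).sub (h2.const_mul p)).congr_deriv ?_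
    rw [logDeriv_id', one_div, inv_re, normSq_apply]
    simp
    have : x ^ 2 + τ ^ 2 ≠ 0 := by positivity
    have : x * x + τ * τ ≠ 0 := by nlinarith [mul_pos hτ hτ, mul_self_nonneg x]
    have : 1 + (x / τ) ^ 2 ≠ 0 := by positivity
    field_simp
    ring
  · apply Continuous.intervalIntegrable
    have : ∀ x : ℝ, x ^ 2 + τ ^ 2 ≠ 0 := fun x => by positivity
    fun_prop (disch := assumption)

theorem tendsto_mul_log_norm (x : ℝ) :
    Tendsto (fun τ : ℝ => τ * Real.log ‖(x : ℂ) + τ * I‖) (𝓝[>] 0) (𝓝 0) := by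
  apply tendsto_nhdsWithin_of_tendsto_nhds
  by_cases hx : x = 0
  · have e : (fun τ : ℝ => τ * Real.log ‖(x : ℂ) + τ * I‖) = fun τ => τ * Real.log τ := by
      ext τ; simp [hx]
    rw [e]
    simpa using Real.continuous_mul_log.tendsto 0
  · have h : ContinuousAt (fun τ : ℝ => τ * Real.log ‖(x : ℂ) + τ * I‖) 0 := by
      refine continuousAt_id.mul (ContinuousAt.log (by fun_prop) ?_)
      simpa using hx
    simpa [ContinuousAt] using h

/-- As `τ → 0+` the kernel `τ / (x² + τ²)` concentrates mass `π` at the origin, where the weight is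
`-p`. When `p = 0` the zero lies on the left edge and the vanishing weight makes the limit `0`
regardless. -/
theorem tendsto_integral_weight_zero {p q : ℝ} (hp : p ≤ 0) (hq : 0 < q) :
    Tendsto (fun τ : ℝ => ∫ x in p..q, (x - p) * -(logDeriv (fun s : ℂ => s) (x + τ * I)).im)
      (𝓝[>] 0) (𝓝 (-p * Real.pi)) := by
  have h1 : Tendsto (fun τ : ℝ => τ * (Real.log ‖(q : ℂ) + τ * I‖ - Real.log ‖(p : ℂ) + τ * I‖))
      (𝓝[>] 0) (𝓝 0) := by
    simpa [mul_sub] using (tendsto_mul_log_norm q).sub (tendsto_mul_log_norm p)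
  have hat : ∀ x : ℝ, 0 < x → Tendsto (fun τ : ℝ => Real.arctan (x / τ)) (𝓝[>] 0)
      (𝓝 (Real.pi / 2)) := fun x hx => by
    refine (tendsto_nhds_of_tendsto_nhdsWithin Real.tendsto_arctan_atTop).comp ?_
    exact (tendsto_inv_nhdsGT_zero.const_mul_atTop hx).congr fun τ => (div_eq_mul_inv x τ).symm
  have h2 : Tendsto (fun τ : ℝ => p * (Real.arctan (q / τ) - Real.arctan (p / τ))) (𝓝[>] 0)
      (𝓝 (p * Real.pi)) := by
    rcases hp.eq_or_lt with rfl | hp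
    · simp
    · have h3 := hat (-p) (by linarith)
      simp_rw [neg_div, Real.arctan_neg] at h3
      have := ((hat q hq).add h3).const_mul p
      simpa [sub_eq_add_neg] using this
  have h3 := h1.sub h2
  rw [zero_sub, ← neg_mul] at h3
  exact h3.congr' (eventually_mem_nhdsWithin.mono fun τ hτ =>
    (integral_weight_div_sq_add_sq p q hτ).symm)

theorem abs_log_norm_le {x t : ℝ} (hx : x ≠ 0) (ht : |t| ≤ 1) :
    |Real.log ‖(x : ℂ) + t * I‖| ≤ |Real.log x| + |x| := by
  have h0 : 0 < |x| := abs_pos.2 hx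
  have h1 : |x| ≤ ‖(x : ℂ) + t * I‖ := by simpa using abs_re_le_norm ((x : ℂ) + t * I)
  have h2 : ‖(x : ℂ) + t * I‖ ≤ |x| + 1 := by
    refine (norm_add_le _ _).trans ?_
    simpa using ht
  rw [abs_le]
  constructor
  · have h3 := Real.log_le_log h0 h1
    rw [Real.log_abs] at h3
    have := neg_abs_le (Real.log x)
    linarith
  · have h3 := Real.log_le_sub_one_of_pos (h0.trans_le h1)
    have := abs_nonneg (Real.log x)
    linarith

theorem tendsto_weightedLogIntegral_id_zero (p q : ℝ) :
    Tendsto (weightedLogIntegral (fun s => s) p q) (𝓝 0)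
      (𝓝 (weightedLogIntegral (fun s => s) p q 0)) := by
  refine tendsto_integral_filter_of_dominated_convergence
    (fun x => |x - p| * (|Real.log x| + |x|)) ?_ ?_ ?_ ?_
  · filter_upwards with t
    have := intervalIntegrable_weighted_log_norm (f := fun s => s) differentiable_id p q t
    exact this.def'.aestronglyMeasurable
  · filter_upwards [Metric.ball_mem_nhds (0 : ℝ) one_pos] with t ht
    have hne : ∀ᵐ x : ℝ, x ≠ 0 := by simp [ae_iff]
    filter_upwards [hne] with x hx _
    rw [norm_mul, Real.norm_eq_abs, Real.norm_eq_abs]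
    gcongr
    exact abs_log_norm_le hx (by simpa using (mem_ball_zero_iff.1 ht).le)
  · refine IntervalIntegrable.continuousOn_mul ?_ (by fun_prop)
    exact intervalIntegral.intervalIntegrable_log'.abs.add (continuous_abs.intervalIntegrable _ _)
  · have hne : ∀ᵐ x : ℝ, x ≠ 0 := by simp [ae_iff]
    filter_upwards [hne] with x hx _
    have h : ContinuousAt (fun t : ℝ => (x - p) * Real.log ‖(x : ℂ) + t * I‖) 0 := by
      refine continuousAt_const.mul (ContinuousAt.log (by fun_prop) ?_)
      simpa using hx
    exact h

theorem continuous_integral_logDensity {p q : ℝ} (hq : 0 < q) :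
    Continuous fun t => ∫ τ in (0 : ℝ)..t, logDensity p q τ :=
  intervalIntegral.continuous_primitive (intervalIntegrable_logDensity hq) 0

/-- On heights `[ε, t]` the identity is zero-free. Letting `ε → 0+`, first in the formula for `κ`
and then in that for `U`, gives the boundary value `-pπ` of `κ` and removes the singular height. -/
theorem weightedLogIntegral_id_of_pos {p q : ℝ} (hp : p ≤ 0) (hq : 0 < q) {t : ℝ} (ht : 0 < t) :
    weightedLogIntegral (fun s => s) p q t - weightedLogIntegral (fun s => s) p q 0 =
      ∫ τ in (0 : ℝ)..t, ((∫ u in (0 : ℝ)..τ, logDensity p q u) - p * Real.pi) := by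
  set E : ℝ → ℝ := fun t => ∫ τ in (0 : ℝ)..t, logDensity p q τ with hE
  have hEc : Continuous E := continuous_integral_logDensity hq
  set κ : ℝ → ℝ := fun τ => ∫ x in p..q, (x - p) * -(logDeriv (fun s : ℂ => s) (x + τ * I)).im
    with hκ
  have hg : ∀ ε t : ℝ, AnalyticOnNhd ℂ (fun s : ℂ => s) (Icc p q ×ℂ Icc ε t) :=
    fun _ _ _ _ => analyticAt_id
  have h0 : ∀ ε t : ℝ, 0 < ε → ∀ s ∈ Icc p q ×ℂ Icc ε t, s ≠ 0 := by
    rintro ε t hε s hs rfl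
    rw [mem_reProdIm] at hs
    have := hs.2.1
    simp at this
    linarith
  have hpq : p ≤ q := by linarith
  have hκE : ∀ t : ℝ, 0 < t → κ t = E t - p * Real.pi := by
    intro t ht
    have hev : ∀ᶠ ε : ℝ in 𝓝[>] 0, κ t - κ ε = E t - E ε := by
      filter_upwards [Ioo_mem_nhdsGT ht] with ε hε
      have := integral_weight_im_logDeriv_sub (hg ε t) (h0 ε t hε.1) hpq
        (left_mem_Icc.2 hε.2.le) (right_mem_Icc.2 hε.2.le)
      simp only [hκ, hE]
      rw [this, integral_interval_sub_left (intervalIntegrable_logDensity hq 0 t)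
        (intervalIntegrable_logDensity hq 0 ε)]
      simp only [logDeriv_id', logDensity]
    have hl1 : Tendsto (fun ε => κ t - κ ε) (𝓝[>] 0) (𝓝 (κ t - (-p * Real.pi))) :=
      tendsto_const_nhds.sub (tendsto_integral_weight_zero hp hq)
    have hl2 : Tendsto (fun ε => E t - E ε) (𝓝[>] 0) (𝓝 (E t - E 0)) :=
      tendsto_const_nhds.sub (tendsto_nhdsWithin_of_tendsto_nhds (hEc.tendsto 0))
    have := tendsto_nhds_unique (hl1.congr' hev) hl2
    have hE0 : E 0 = 0 := by simp [hE]
    rw [hE0] at this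
    linarith
  have hev : ∀ᶠ ε : ℝ in 𝓝[>] 0, weightedLogIntegral (fun s => s) p q t -
      weightedLogIntegral (fun s => s) p q ε = ∫ τ in ε..t, (E τ - p * Real.pi) := by
    filter_upwards [Ioo_mem_nhdsGT ht] with ε hε
    rw [weightedLogIntegral_sub_of_ne_zero (hg ε t) (h0 ε t hε.1) hpq
        (left_mem_Icc.2 hε.2.le) (right_mem_Icc.2 hε.2.le)]
    apply integral_congr
    intro τ hτ
    rw [uIcc_of_le hε.2.le] at hτ
    exact hκE τ (hε.1.trans_le hτ.1)
  have hl1 := (tendsto_const_nhds (x := weightedLogIntegral (fun s => s) p q t)).sub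
    (tendsto_nhdsWithin_of_tendsto_nhds (s := Ioi 0) (tendsto_weightedLogIntegral_id_zero p q))
  have hci : ∀ a b : ℝ, IntervalIntegrable (fun τ => E τ - p * Real.pi) volume a b :=
    fun a b => (hEc.sub continuous_const).intervalIntegrable a b
  have hl2 : Tendsto (fun ε => ∫ τ in ε..t, (E τ - p * Real.pi)) (𝓝[>] 0)
      (𝓝 (∫ τ in (0 : ℝ)..t, (E τ - p * Real.pi))) := by
    have hc := (intervalIntegral.continuous_primitive hci t).neg.tendsto 0
    simp only [Pi.neg_apply, ← integral_symm] at hc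
    exact tendsto_nhdsWithin_of_tendsto_nhds (hc.congr fun ε => (integral_symm t ε).symm)
  exact tendsto_nhds_unique (hl1.congr' hev) hl2

theorem weightedLogIntegral_id_neg (p q t : ℝ) :
    weightedLogIntegral (fun s => s) p q (-t) = weightedLogIntegral (fun s => s) p q t := by
  unfold weightedLogIntegral
  simp_rw [norm_ofReal_add_neg_mul_I]

theorem integral_logDensity_neg (p q t : ℝ) :
    ∫ u in (0 : ℝ)..(-t), logDensity p q u = -∫ u in (0 : ℝ)..t, logDensity p q u := by
  have h := intervalIntegral.integral_comp_neg (a := 0) (b := t) (logDensity p q)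
  simp_rw [logDensity_neg, neg_zero] at h
  rw [h, ← integral_symm]

/-- The derivative of the weighted logarithmic integral of the identity function. -/
noncomputable def logDensityPrimitive (p q τ : ℝ) : ℝ :=
  (∫ u in (0 : ℝ)..τ, logDensity p q u) - p * Real.pi * (if 0 ≤ τ then 1 else -1)

theorem intervalIntegrable_logDensityPrimitive {p q : ℝ} (hq : 0 < q) (t t' : ℝ) :
    IntervalIntegrable (logDensityPrimitive p q) volume t t' := by
  refine ((continuous_integral_logDensity hq).intervalIntegrable t t').sub
    (IntervalIntegrable.const_mul ?_ _)
  have hm : Measurable fun τ : ℝ => if 0 ≤ τ then (1 : ℝ) else -1 :=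
    Measurable.ite measurableSet_Ici measurable_const measurable_const
  refine (intervalIntegrable_const (c := (1 : ℝ))).mono_fun hm.aestronglyMeasurable
    (Eventually.of_forall fun τ => ?_)
  simp only
  split_ifs <;> simp

/-- Negative heights follow by symmetry: `U` is even in `t`, so its derivative is odd apart from the
value at the single point `0`. -/
theorem weightedLogIntegral_id_sub_zero {p q : ℝ} (hp : p ≤ 0) (hq : 0 < q) (t : ℝ) :
    weightedLogIntegral (fun s => s) p q t - weightedLogIntegral (fun s => s) p q 0 =
      ∫ τ in (0 : ℝ)..t, logDensityPrimitive p q τ := by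
  rcases lt_trichotomy t 0 with ht | rfl | ht
  · have h := weightedLogIntegral_id_of_pos hp hq (neg_pos.2 ht)
    rw [weightedLogIntegral_id_neg] at h
    have h2 := intervalIntegral.integral_comp_neg (a := 0) (b := t)
      fun τ => (∫ u in (0 : ℝ)..τ, logDensity p q u) - p * Real.pi
    rw [neg_zero, integral_symm 0 (-t)] at h2
    rw [h, ← neg_eq_iff_eq_neg.2 h2, ← intervalIntegral.integral_neg]
    apply intervalIntegral.integral_congr_ae
    have hne : ∀ᵐ x : ℝ, x ≠ 0 := by simp [ae_iff]
    filter_upwards [hne] with τ hτ hτ'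
    rw [uIoc_of_ge ht.le] at hτ'
    have : ¬ 0 ≤ τ := not_le.2 (lt_of_le_of_ne hτ'.2 hτ)
    rw [integral_logDensity_neg, logDensityPrimitive, if_neg this]
    ring
  · simp
  · rw [weightedLogIntegral_id_of_pos hp hq ht]
    apply integral_congr
    intro τ hτ
    rw [uIcc_of_le ht.le] at hτ
    simp [logDensityPrimitive, hτ.1]

theorem weightedLogIntegral_sub_const {σ b t : ℝ} (ρ : ℂ) :
    weightedLogIntegral (fun s => s - ρ) σ b t =
      weightedLogIntegral (fun s => s) (σ - ρ.re) (b - ρ.re) (t - ρ.im) := by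
  unfold weightedLogIntegral
  rw [← intervalIntegral.integral_comp_sub_right _ ρ.re]
  congr 1
  ext x
  congr 1
  · ring
  · congr 2
    apply Complex.ext <;> simp

theorem weightedLogIntegral_factor {σ b : ℝ} {ρ : ℂ} (h1 : σ ≤ ρ.re) (h2 : ρ.re < b) (t' t : ℝ) :
    weightedLogIntegral (fun s => s - ρ) σ b t - weightedLogIntegral (fun s => s - ρ) σ b t' =
      ∫ τ in t'..t, logDensityPrimitive (σ - ρ.re) (b - ρ.re) (τ - ρ.im) := by
  have hp : σ - ρ.re ≤ 0 := by linarith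
  have hq : 0 < b - ρ.re := by linarith
  rw [weightedLogIntegral_sub_const, weightedLogIntegral_sub_const,
    intervalIntegral.integral_comp_sub_right (logDensityPrimitive (σ - ρ.re) (b - ρ.re)),
    ← integral_interval_sub_left (a := 0) (intervalIntegrable_logDensityPrimitive hq _ _)
      (intervalIntegrable_logDensityPrimitive hq _ _), ← weightedLogIntegral_id_sub_zero hp hq,
    ← weightedLogIntegral_id_sub_zero hp hq]
  ring

/-- The jump of `-pπ · sign` across the height of `ρ` is `2π(β - σ)`. Taking the value `+1` at
height difference `0` charges it to the half-open range `t' < γ ≤ t`, which matches the cutoff `γ ≤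
T` of the zero sum. -/
theorem logDensityPrimitive_sub {σ b : ℝ} {ρ : ℂ} (h2 : ρ.re < b) {t' t : ℝ} (htt : t' ≤ t) :
    logDensityPrimitive (σ - ρ.re) (b - ρ.re) (t - ρ.im) -
        logDensityPrimitive (σ - ρ.re) (b - ρ.re) (t' - ρ.im) =
      (∫ τ in t'..t, (Real.log ‖((b : ℂ) + τ * I) - ρ‖ - Real.log ‖((σ : ℂ) + τ * I) - ρ‖ -
        (b - σ) * (1 / ((b : ℂ) + τ * I - ρ)).re)) +
      2 * Real.pi * (if t' < ρ.im ∧ ρ.im ≤ t then ρ.re - σ else 0) := by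
  have hq : 0 < b - ρ.re := by linarith
  have e : ∀ τ : ℝ, Real.log ‖((b : ℂ) + τ * I) - ρ‖ - Real.log ‖((σ : ℂ) + τ * I) - ρ‖ -
        (b - σ) * (1 / ((b : ℂ) + τ * I - ρ)).re =
        logDensity (σ - ρ.re) (b - ρ.re) (τ - ρ.im) := by
    intro τ
    have h : ∀ x : ℝ, (x : ℂ) + τ * I - ρ = ((x - ρ.re : ℝ) : ℂ) + ((τ - ρ.im : ℝ) : ℂ) * I :=
      fun x => by apply Complex.ext <;> simp
    rw [h, h, logDensity]
    ring
  simp_rw [e]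
  rw [intervalIntegral.integral_comp_sub_right (logDensity (σ - ρ.re) (b - ρ.re)),
    ← integral_interval_sub_left (a := 0) (intervalIntegrable_logDensity hq _ _)
      (intervalIntegrable_logDensity hq _ _), logDensityPrimitive, logDensityPrimitive]
  simp only [sub_nonneg]
  by_cases h3 : ρ.im ≤ t'
  · have h4 : ρ.im ≤ t := h3.trans htt
    rw [if_pos h3, if_pos h4, if_neg (fun h => absurd h.1 (not_lt.2 h3))]
    ring
  · by_cases h4 : ρ.im ≤ t
    · rw [if_neg h3, if_pos h4, if_pos ⟨not_le.1 h3, h4⟩]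
      ring
    · rw [if_neg h3, if_neg h4, if_neg (fun h => h4 h.2)]
      ring

end

/-! ### Factoring out the zeros, and Littlewood's lemma in general. -/

section

open Complex Set MeasureTheory intervalIntegral Filter Topology

theorem finite_zeros_of_isCompact {f : ℂ → ℂ} (hf : Differentiable ℂ f) {s₀ : ℂ} (h0 : f s₀ ≠ 0)
    {K : Set ℂ} (hK : IsCompact K) : {ρ : ℂ | f ρ = 0 ∧ ρ ∈ K}.Finite := by
  by_contra hinf
  obtain ⟨z, -, hz⟩ := Set.Infinite.exists_accPt_of_subset_isCompact hinf hK (fun ρ hρ => hρ.2)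
  rw [accPt_iff_frequently_nhdsNE] at hz
  have h := (hf.differentiableOn.analyticOnNhd isOpen_univ).eqOn_zero_of_preconnected_of_frequently_eq_zero
    isPreconnected_univ (mem_univ z) (hz.mono fun ρ hρ => hρ.1)
  exact h0 (h (mem_univ s₀))

theorem analyticOrderAt_ne_top_of_differentiable {f : ℂ → ℂ} (hf : Differentiable ℂ f) {s₀ : ℂ}
    (h0 : f s₀ ≠ 0) (ρ : ℂ) : analyticOrderAt f ρ ≠ ⊤ := by
  intro h
  rw [analyticOrderAt_eq_top] at h
  have := (hf.differentiableOn.analyticOnNhd isOpen_univ).eqOn_zero_of_preconnected_of_eventuallyEq_zero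
    isPreconnected_univ (mem_univ ρ) h
  exact h0 (this (mem_univ s₀))

/-- An entire function can be divided by the power of `s - ρ` given by its order at `ρ`. -/
theorem exists_entire_eq_pow_mul {f : ℂ → ℂ} (hf : Differentiable ℂ f) {ρ : ℂ}
    (h : analyticOrderAt f ρ ≠ ⊤) :
    ∃ g : ℂ → ℂ, Differentiable ℂ g ∧ g ρ ≠ 0 ∧
      ∀ s, f s = (s - ρ) ^ analyticOrderNatAt f ρ * g s := by
  set n := analyticOrderNatAt f ρ with hn
  obtain ⟨g, hg, hg0, hgf⟩ := ((hf.analyticAt ρ).analyticOrderAt_eq_natCast (n := n)).1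
    (Nat.cast_analyticOrderNatAt h).symm
  have hev : Function.update (fun s => f s / (s - ρ) ^ n) ρ (g ρ) =ᶠ[𝓝 ρ] g := by
    filter_upwards [hgf] with s hs
    by_cases hsρ : s = ρ
    · rw [hsρ, Function.update_self]
    · rw [Function.update_of_ne hsρ, hs, smul_eq_mul, mul_div_cancel_left₀ _
        (pow_ne_zero _ (sub_ne_zero.2 hsρ))]
  refine ⟨Function.update (fun s => f s / (s - ρ) ^ n) ρ (g ρ), fun s => ?_, ?_, fun s => ?_⟩
  · by_cases hsρ : s = ρ
    · rw [hsρ]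
      exact hg.differentiableAt.congr_of_eventuallyEq hev
    · have h1 : DifferentiableAt ℂ (fun s => f s / (s - ρ) ^ n) s :=
        (hf s).div (by fun_prop) (pow_ne_zero _ (sub_ne_zero.2 hsρ))
      refine h1.congr_of_eventuallyEq ?_
      filter_upwards [isOpen_ne.mem_nhds hsρ] with z hz
      exact Function.update_of_ne hz _ _
  · rwa [Function.update_self]
  · by_cases hsρ : s = ρ
    · rw [hsρ, Function.update_self]
      simpa using hgf.self_of_nhds
    · rw [Function.update_of_ne hsρ, mul_div_cancel₀ _ (pow_ne_zero _ (sub_ne_zero.2 hsρ))]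

/-- Zeros are removed one at a time; the factors already extracted do not vanish at the next zero,
so its order in the cofactor is still its order in `f`. -/
theorem exists_entire_eq_prod_mul {f : ℂ → ℂ} (hf : Differentiable ℂ f) {s₀ : ℂ} (h0 : f s₀ ≠ 0)
    (Z : Finset ℂ) :
    ∃ g : ℂ → ℂ, Differentiable ℂ g ∧ (∀ ρ ∈ Z, g ρ ≠ 0) ∧
      ∀ s, f s = (∏ ρ ∈ Z, (s - ρ) ^ analyticOrderNatAt f ρ) * g s := by
  classical
  induction Z using Finset.induction_on with
  | empty => exact ⟨f, hf, by simp, by simp⟩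
  | insert ρ Z hρ ih =>
    obtain ⟨g, hg, hgZ, hfg⟩ := ih
    set P : ℂ → ℂ := fun s => ∏ ρ ∈ Z, (s - ρ) ^ analyticOrderNatAt f ρ with hP
    have hPd : Differentiable ℂ P := by
      intro s
      exact DifferentiableAt.fun_finsetProd fun i _ => by fun_prop
    have hPρ : P ρ ≠ 0 := Finset.prod_ne_zero_iff.2 fun i hi =>
      pow_ne_zero _ (sub_ne_zero.2 fun h => hρ (h ▸ hi))
    have hord : analyticOrderAt f ρ = analyticOrderAt g ρ := by
      have : f = P * g := funext hfg
      rw [this, analyticOrderAt_mul (hPd.analyticAt ρ) (hg.analyticAt ρ),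
        (hPd.analyticAt ρ).analyticOrderAt_eq_zero.2 hPρ, zero_add]
    have hordN : analyticOrderNatAt f ρ = analyticOrderNatAt g ρ := by
      rw [analyticOrderNatAt, analyticOrderNatAt, hord]
    obtain ⟨g₁, hg₁, hg₁ρ, hgg₁⟩ := exists_entire_eq_pow_mul hg (ρ := ρ)
      (hord ▸ analyticOrderAt_ne_top_of_differentiable hf h0 ρ)
    refine ⟨g₁, hg₁, fun z hz => ?_, fun s => ?_⟩
    · rcases Finset.mem_insert.1 hz with rfl | hz
      · exact hg₁ρ
      · have := hgZ z hz
        rw [hgg₁] at this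
        exact right_ne_zero_of_mul this
    · rw [Finset.prod_insert hρ, hfg, hgg₁, hordN]
      ring

theorem log_norm_prod_mul {g : ℂ → ℂ} {Z : Finset ℂ} {n : ℂ → ℕ} {s : ℂ} (hs : s ∉ Z) (hg : g s ≠ 0) :
    Real.log ‖(∏ ρ ∈ Z, (s - ρ) ^ n ρ) * g s‖ =
      (∑ ρ ∈ Z, (n ρ : ℝ) * Real.log ‖s - ρ‖) + Real.log ‖g s‖ := by
  have h : ∀ ρ ∈ Z, s - ρ ≠ 0 := fun ρ hρ => sub_ne_zero.2 fun h => hs (h ▸ hρ)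
  rw [norm_mul, Real.log_mul (norm_ne_zero_iff.2 (Finset.prod_ne_zero_iff.2 fun ρ hρ =>
    pow_ne_zero _ (h ρ hρ))) (norm_ne_zero_iff.2 hg), norm_prod, Real.log_prod fun ρ hρ =>
    norm_ne_zero_iff.2 (pow_ne_zero _ (h ρ hρ))]
  simp [Real.log_pow]

theorem logDeriv_prod_mul {g : ℂ → ℂ} (hgd : Differentiable ℂ g) {Z : Finset ℂ} {n : ℂ → ℕ} {s : ℂ}
    (hs : s ∉ Z) (hg : g s ≠ 0) :
    logDeriv (fun s => (∏ ρ ∈ Z, (s - ρ) ^ n ρ) * g s) s =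
      (∑ ρ ∈ Z, (n ρ : ℂ) * (1 / (s - ρ))) + logDeriv g s := by
  have h : ∀ ρ ∈ Z, s - ρ ≠ 0 := fun ρ hρ => sub_ne_zero.2 fun h => hs (h ▸ hρ)
  rw [logDeriv_mul (f := fun s => ∏ ρ ∈ Z, (s - ρ) ^ n ρ) s (Finset.prod_ne_zero_iff.2 fun ρ hρ =>
    pow_ne_zero _ (h ρ hρ)) hg (DifferentiableAt.fun_finsetProd fun i _ => by fun_prop) (hgd s),
    logDeriv_prod (f := fun ρ s => (s - ρ) ^ n ρ) (fun ρ hρ => pow_ne_zero _ (h ρ hρ))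
      (fun i _ => by fun_prop)]
  congr 1
  refine Finset.sum_congr rfl fun ρ _ => ?_
  rw [logDeriv_fun_pow (f := fun s => s - ρ) (by fun_prop), logDeriv_apply]
  simp

/-- The logarithm of the factorization is additive only off the zeros, because `Real.log 0 = 0`;
under the integral a null set does not matter. -/
theorem ae_horizontal_notMem (Z : Finset ℂ) (t : ℝ) : ∀ᵐ x : ℝ, (x : ℂ) + t * I ∉ Z := by
  have hf : (Z : Set ℂ).Finite := Z.finite_toSet
  have : {x : ℝ | (x : ℂ) + t * I ∈ Z}.Finite := by
    refine hf.preimage (f := fun x : ℝ => (x : ℂ) + t * I) fun x _ y _ hxy => ?_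
    simpa using hxy
  simpa [ae_iff] using this.measure_zero volume

theorem ae_vertical_notMem (Z : Finset ℂ) (x : ℝ) : ∀ᵐ t : ℝ, (x : ℂ) + t * I ∉ Z := by
  have hf : (Z : Set ℂ).Finite := Z.finite_toSet
  have : {t : ℝ | (x : ℂ) + t * I ∈ Z}.Finite := by
    refine hf.preimage (f := fun t : ℝ => (x : ℂ) + t * I) fun x _ y _ hxy => ?_
    simpa [I_ne_zero] using hxy
  simpa [ae_iff] using this.measure_zero volume

/-- The integrand of the change of the derivative of the weighted logarithmic integral. -/
noncomputable def littlewoodIntegrand (f : ℂ → ℂ) (σ b τ : ℝ) : ℝ :=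
  Real.log ‖f (b + τ * I)‖ - Real.log ‖f (σ + τ * I)‖ - (b - σ) * (logDeriv f (b + τ * I)).re

theorem continuousOn_re_logDeriv_vertical {f : ℂ → ℂ} (hf : Differentiable ℂ f) {b t₁ T : ℝ}
    (hb : ∀ t ∈ Icc t₁ T, f (b + t * I) ≠ 0) :
    ContinuousOn (fun τ : ℝ => (logDeriv f (b + τ * I)).re) (Icc t₁ T) := by
  refine continuous_re.comp_continuousOn (ContinuousOn.div ?_ ?_ fun t ht => hb t ht)
  · exact (hf.deriv.continuous.comp (by fun_prop)).continuousOn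
  · exact (hf.continuous.comp (by fun_prop)).continuousOn

theorem intervalIntegrable_littlewoodIntegrand {f : ℂ → ℂ} (hf : Differentiable ℂ f)
    {σ b t₁ T : ℝ} (hb : ∀ t ∈ Icc t₁ T, f (b + t * I) ≠ 0) {t' t : ℝ} (ht' : t' ∈ Icc t₁ T)
    (ht : t ∈ Icc t₁ T) : IntervalIntegrable (littlewoodIntegrand f σ b) volume t' t := by
  refine ((intervalIntegrable_log_norm_vertical hf b t' t).sub
    (intervalIntegrable_log_norm_vertical hf σ t' t)).sub (IntervalIntegrable.const_mul ?_ _)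
  exact ((continuousOn_re_logDeriv_vertical hf hb).mono (uIcc_subset_Icc ht' ht)).intervalIntegrable

/-- **Littlewood's lemma** for a rectangle, in a form without arguments: the weighted logarithmic
integral has a derivative `κ` whose increments count the zeros. -/
theorem exists_deriv_weightedLogIntegral {f : ℂ → ℂ} (hf : Differentiable ℂ f) {σ b t₁ T : ℝ}
    (hσb : σ < b) (hT : t₁ ≤ T) (hb : ∀ t ∈ Icc t₁ T, f (b + t * I) ≠ 0) :
    ∃ (κ : ℝ → ℝ) (Z : Finset ℂ), IntervalIntegrable κ volume t₁ T ∧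
      (∀ ρ, ρ ∈ Z ↔ f ρ = 0 ∧ ρ ∈ Icc σ b ×ℂ Icc t₁ T) ∧
      (∀ t' ∈ Icc t₁ T, ∀ t ∈ Icc t₁ T,
        weightedLogIntegral f σ b t - weightedLogIntegral f σ b t' = ∫ τ in t'..t, κ τ) ∧
      ∀ t' ∈ Icc t₁ T, ∀ t ∈ Icc t₁ T, t' ≤ t →
        κ t - κ t' = (∫ τ in t'..t, littlewoodIntegrand f σ b τ) + 2 * Real.pi *
          ∑ ρ ∈ Z with t' < ρ.im ∧ ρ.im ≤ t, (analyticOrderNatAt f ρ : ℝ) * (ρ.re - σ) := by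
  classical
  set S := Icc σ b ×ℂ Icc t₁ T with hS
  have hSc : IsCompact S := isCompact_Icc.reProdIm isCompact_Icc
  have h0 : f (b + t₁ * I) ≠ 0 := hb t₁ (left_mem_Icc.2 hT)
  have hZf := finite_zeros_of_isCompact hf h0 hSc
  set Z := hZf.toFinset with hZ
  have hZmem : ∀ ρ, ρ ∈ Z ↔ f ρ = 0 ∧ ρ ∈ S := fun ρ => by simp [hZ]
  obtain ⟨g, hg, hgZ, hfg⟩ := exists_entire_eq_prod_mul hf h0 Z
  set n := analyticOrderNatAt f with hn
  have hgS : ∀ s ∈ S, g s ≠ 0 := by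
    intro s hs hgs
    by_cases hsZ : s ∈ Z
    · exact hgZ s hsZ hgs
    · exact hsZ ((hZmem s).2 ⟨by rw [hfg, hgs, mul_zero], hs⟩)
  have hgan : AnalyticOnNhd ℂ g S := fun s _ => hg.analyticAt s
  -- Nonvanishing on the right edge gives the strict inequality that the single-zero lemmas need;
  -- the left edge may carry zeros.
  have hre : ∀ ρ ∈ Z, σ ≤ ρ.re ∧ ρ.re < b := by
    intro ρ hρ
    obtain ⟨h1, h2⟩ := (hZmem ρ).1 hρ
    rw [hS, mem_reProdIm] at h2
    refine ⟨h2.1.1, lt_of_le_of_ne h2.1.2 fun h => hb ρ.im h2.2 ?_⟩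
    rwa [← h, re_add_im]
  have hbZ : ∀ t : ℝ, (b : ℂ) + t * I ∉ Z := fun t h => by
    have := (hre _ h).2
    simp at this
  set κg : ℝ → ℝ := fun τ => ∫ x in σ..b, (x - σ) * -(logDeriv g (x + τ * I)).im with hκg
  set κZ : ℂ → ℝ → ℝ := fun ρ τ => logDensityPrimitive (σ - ρ.re) (b - ρ.re) (τ - ρ.im) with hκZ
  have hκZi : ∀ ρ ∈ Z, ∀ a c : ℝ, IntervalIntegrable (κZ ρ) volume a c := fun ρ hρ a c => by
    have := (intervalIntegrable_logDensityPrimitive (p := σ - ρ.re) (sub_pos.2 (hre ρ hρ).2)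
      (a - ρ.im) (c - ρ.im)).comp_sub_right ρ.im
    simpa using this
  -- Continuity is read off from the increment formula, which exhibits `κg` as a primitive.
  have hκgc : ContinuousOn κg (Icc t₁ T) := by
    have hF : ContinuousOn (fun t => κg t₁ + ∫ τ in t₁..t, littlewoodIntegrand g σ b τ)
        (Icc t₁ T) := by
      refine continuousOn_const.add ?_
      have := intervalIntegrable_littlewoodIntegrand hg (σ := σ) (b := b) (t₁ := t₁) (T := T)
        (fun t ht => hgS _ (mem_rect (right_mem_Icc.2 hσb.le) ht))
        (left_mem_Icc.2 hT) (right_mem_Icc.2 hT)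
      have := intervalIntegral.continuousOn_primitive_interval' this left_mem_uIcc
      rwa [uIcc_of_le hT] at this
    refine hF.congr fun t ht => ?_
    have := integral_weight_im_logDeriv_sub hgan hgS hσb.le (left_mem_Icc.2 hT) ht
    simp only [hκg, littlewoodIntegrand, ← this]
    ring
  have hκgi : ∀ t' ∈ Icc t₁ T, ∀ t ∈ Icc t₁ T, IntervalIntegrable κg volume t' t :=
    fun t' ht' t ht => (hκgc.mono (uIcc_subset_Icc ht' ht)).intervalIntegrable
  have hκsum : ∀ a c : ℝ, IntervalIntegrable (fun τ => ∑ ρ ∈ Z, (n ρ : ℝ) * κZ ρ τ) volume a c :=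
    fun a c => by
      have := IntervalIntegrable.sum Z (f := fun ρ τ => (n ρ : ℝ) * κZ ρ τ) (a := a) (b := c)
        (μ := volume) fun ρ hρ => (hκZi ρ hρ a c).const_mul _
      simpa [Finset.sum_fn] using this
  have hdU : ∀ ρ : ℂ, Differentiable ℂ fun s => s - ρ := fun ρ => by fun_prop
  have hU : ∀ t ∈ Icc t₁ T, weightedLogIntegral f σ b t =
      (∑ ρ ∈ Z, (n ρ : ℝ) * weightedLogIntegral (fun s => s - ρ) σ b t) +
        weightedLogIntegral g σ b t := by
    intro t ht
    have hi : ∀ ρ ∈ Z, IntervalIntegrable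
        (fun x : ℝ => (n ρ : ℝ) * ((x - σ) * Real.log ‖(x : ℂ) + t * I - ρ‖)) volume σ b :=
      fun ρ _ => (intervalIntegrable_weighted_log_norm (hdU ρ) σ b t).const_mul _
    simp only [weightedLogIntegral]
    simp_rw [← intervalIntegral.integral_const_mul]
    rw [← intervalIntegral.integral_finsetSum hi, ← intervalIntegral.integral_add
      (by simpa [Finset.sum_fn] using IntervalIntegrable.sum Z hi)
      (intervalIntegrable_weighted_log_norm hg σ b t)]
    apply intervalIntegral.integral_congr_ae
    filter_upwards [ae_horizontal_notMem Z t] with x hx hxI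
    rw [uIoc_of_le hσb.le] at hxI
    rw [hfg, log_norm_prod_mul hx (hgS _ (mem_rect (Ioc_subset_Icc_self hxI) ht)), mul_add,
      Finset.mul_sum]
    congr 1
    exact Finset.sum_congr rfl fun ρ _ => by ring
  refine ⟨fun τ => (∑ ρ ∈ Z, (n ρ : ℝ) * κZ ρ τ) + κg τ, Z,
    (hκsum t₁ T).add (hκgi _ (left_mem_Icc.2 hT) _ (right_mem_Icc.2 hT)), hZmem, ?_, ?_⟩
  · intro t' ht' t ht
    rw [intervalIntegral.integral_add (hκsum t' t) (hκgi t' ht' t ht),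
      intervalIntegral.integral_finsetSum fun ρ hρ => (hκZi ρ hρ t' t).const_mul _,
      hU t ht, hU t' ht', add_sub_add_comm, weightedLogIntegral_sub_of_ne_zero hgan hgS hσb.le ht' ht,
      ← Finset.sum_sub_distrib]
    congr 1
    refine Finset.sum_congr rfl fun ρ hρ => ?_
    rw [intervalIntegral.integral_const_mul, ← weightedLogIntegral_factor (hre ρ hρ).1 (hre ρ hρ).2]
    ring
  · intro t' ht' t ht htt
    have hgb : ∀ t ∈ Icc t₁ T, g (b + t * I) ≠ 0 :=
      fun t ht => hgS _ (mem_rect (right_mem_Icc.2 hσb.le) ht)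
    have hLi : ∀ ρ ∈ Z, IntervalIntegrable (fun τ : ℝ => (n ρ : ℝ) *
        (Real.log ‖((b : ℂ) + τ * I) - ρ‖ - Real.log ‖((σ : ℂ) + τ * I) - ρ‖ -
        (b - σ) * (1 / ((b : ℂ) + τ * I - ρ)).re)) volume t' t := by
      intro ρ hρ
      have := intervalIntegrable_littlewoodIntegrand (f := fun s => s - ρ) (hdU ρ) (σ := σ) (b := b)
        (t₁ := t₁) (T := T) (fun t _ h => hbZ t (by rwa [sub_eq_zero.1 h])) ht' ht
      refine IntervalIntegrable.const_mul ?_ _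
      refine this.congr fun τ _ => ?_
      simp [littlewoodIntegrand, logDeriv_apply]
    have hLsum : IntervalIntegrable (fun τ : ℝ => ∑ ρ ∈ Z, (n ρ : ℝ) *
        (Real.log ‖((b : ℂ) + τ * I) - ρ‖ - Real.log ‖((σ : ℂ) + τ * I) - ρ‖ -
        (b - σ) * (1 / ((b : ℂ) + τ * I - ρ)).re)) volume t' t := by
      simpa [Finset.sum_fn] using IntervalIntegrable.sum Z hLi
    have hgL := intervalIntegrable_littlewoodIntegrand hg (σ := σ) hgb ht' ht
    have e : ∫ τ in t'..t, littlewoodIntegrand f σ b τ =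
        ∑ ρ ∈ Z, (n ρ : ℝ) * (∫ τ in t'..t, (Real.log ‖((b : ℂ) + τ * I) - ρ‖ -
          Real.log ‖((σ : ℂ) + τ * I) - ρ‖ - (b - σ) * (1 / ((b : ℂ) + τ * I - ρ)).re)) +
        ∫ τ in t'..t, littlewoodIntegrand g σ b τ := by
      simp_rw [← intervalIntegral.integral_const_mul]
      rw [← intervalIntegral.integral_finsetSum hLi, ← intervalIntegral.integral_add hLsum hgL]
      apply intervalIntegral.integral_congr_ae
      filter_upwards [ae_vertical_notMem Z σ] with τ hτ hτI
      rw [uIoc_of_le htt] at hτI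
      have hτT : τ ∈ Icc t₁ T := ⟨ht'.1.trans hτI.1.le, hτI.2.trans ht.2⟩
      have hfe : f = fun s => (∏ ρ ∈ Z, (s - ρ) ^ n ρ) * g s := funext hfg
      have h1 : (logDeriv f (b + τ * I)).re =
          (∑ ρ ∈ Z, (n ρ : ℝ) * (1 / ((b : ℂ) + τ * I - ρ)).re) + (logDeriv g (b + τ * I)).re := by
        rw [hfe, logDeriv_prod_mul hg (hbZ τ) (hgb τ hτT), add_re, re_sum]
        congr 1
        refine Finset.sum_congr rfl fun ρ _ => ?_
        rw [← ofReal_natCast, re_ofReal_mul]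
      rw [littlewoodIntegrand, h1, hfg (b + τ * I), hfg (σ + τ * I), log_norm_prod_mul (hbZ τ) (hgb τ hτT),
        log_norm_prod_mul hτ (hgS _ (mem_rect (left_mem_Icc.2 hσb.le) hτT)), littlewoodIntegrand]
      simp_rw [mul_sub, Finset.sum_sub_distrib, mul_left_comm _ (b - σ), ← Finset.mul_sum]
      ring
    have hκg' : κg t - κg t' = ∫ τ in t'..t, littlewoodIntegrand g σ b τ :=
      integral_weight_im_logDeriv_sub hgan hgS hσb.le ht' ht
    rw [e, add_sub_add_comm, hκg', ← Finset.sum_sub_distrib, Finset.sum_filter, Finset.mul_sum,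
      add_right_comm, ← Finset.sum_add_distrib]
    congr 1
    refine Finset.sum_congr rfl fun ρ hρ => ?_
    rw [← mul_sub, logDensityPrimitive_sub (hre ρ hρ).2 htt]
    split_ifs <;> ring

end

/-! ### Jensen's inequality and good horizontal lines. -/

section

open Complex Set MeasureTheory Filter Topology Metric

/-- Jensen's inequality on a circle. -/
theorem lintegral_circle_log_sub_log_norm_le {f : ℂ → ℂ} (hf : Differentiable ℂ f) {c : ℂ}
    {r M : ℝ} (hr : 0 < r) (hM : ∀ z ∈ closedBall c r, ‖f z‖ ≤ M) (hM1 : 1 ≤ M)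
    (hc : 1 / 2 ≤ ‖f c‖) :
    ∫⁻ θ in Ioo (-Real.pi) Real.pi, ENNReal.ofReal (Real.log M - Real.log ‖f (circleMap c r θ)‖) ≤
      ENNReal.ofReal (2 * Real.pi * (Real.log M + Real.log 2)) := by
  have hfc : f c ≠ 0 := norm_pos_iff.1 (by linarith)
  have hlogM : 0 ≤ Real.log M := Real.log_nonneg hM1
  have hmer : MeromorphicOn f (sphere c r) := fun z _ => (hf.analyticAt z).meromorphicAt
  have hci : CircleIntegrable (fun z => Real.log ‖f z‖) c r :=
    hmer.circleIntegrable_log_norm_of_nonneg hr.le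
  -- In Jensen's formula the zeros inside the circle contribute nonnegative terms, so the average is
  -- at least `log |f(c)| ≥ -log 2`.
  have havg : -Real.log 2 ≤ Real.circleAverage (fun z => Real.log ‖f z‖) c r := by
    rw [AnalyticOnNhd.circleAverage_log_norm hr.ne' (fun z _ => hf.analyticAt z) hfc]
    have h1 : -Real.log 2 ≤ Real.log ‖f c‖ := by
      rw [← Real.log_inv]
      exact Real.log_le_log (by norm_num) (by linarith)
    have h2 : 0 ≤ ∑ᶠ u, MeromorphicOn.divisor f (closedBall c |r|) u *
        Real.log (r * ‖c - u‖⁻¹) := by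
      refine finsum_nonneg fun u => ?_
      by_cases hu : u ∈ closedBall c |r|
      · have h3 : 0 ≤ MeromorphicOn.divisor f (closedBall c |r|) u :=
          MeromorphicOn.AnalyticOnNhd.divisor_nonneg (fun z _ => hf.analyticAt z) u
        refine mul_nonneg (by exact_mod_cast h3) ?_
        by_cases huc : u = c
        · simp [huc]
        · apply Real.log_nonneg
          rw [mem_closedBall, dist_comm, dist_eq_norm, abs_of_pos hr] at hu
          rw [← div_eq_mul_inv, one_le_div (norm_pos_iff.2 (sub_ne_zero.2 (Ne.symm huc)))]
          exact hu
      · rw [Function.locallyFinsuppWithin.apply_eq_zero_of_notMem _ hu]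
        simp
    linarith
  have hle : ∀ θ : ℝ, Real.log ‖f (circleMap c r θ)‖ ≤ Real.log M := by
    intro θ
    by_cases h : f (circleMap c r θ) = 0
    · simpa [h] using hlogM
    · exact Real.log_le_log (norm_pos_iff.2 h) (hM _ (circleMap_mem_closedBall c hr.le θ))
  have hper : Function.Periodic (fun θ => Real.log M - Real.log ‖f (circleMap c r θ)‖)
      (2 * Real.pi) := fun θ => by simp only [periodic_circleMap c r θ]
  have hint : IntervalIntegrable (fun θ => Real.log M - Real.log ‖f (circleMap c r θ)‖) volume 0
      (2 * Real.pi) := intervalIntegrable_const.sub hci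
  have hint2 : IntervalIntegrable (fun θ => Real.log M - Real.log ‖f (circleMap c r θ)‖) volume
      (-Real.pi) Real.pi := hper.intervalIntegrable₀ (by positivity) hint _ _
  have hpi := Real.pi_pos
  have hval : ∫ θ in (-Real.pi)..Real.pi, (Real.log M - Real.log ‖f (circleMap c r θ)‖) ≤
      2 * Real.pi * (Real.log M + Real.log 2) := by
    have h1 := hper.intervalIntegral_add_eq (-Real.pi) 0
    rw [show -Real.pi + 2 * Real.pi = Real.pi by ring, zero_add] at h1
    rw [h1, intervalIntegral.integral_sub intervalIntegrable_const hci]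
    rw [Real.circleAverage, smul_eq_mul, le_inv_mul_iff₀ (by positivity)] at havg
    rw [intervalIntegral.integral_const, smul_eq_mul]
    linarith
  rw [Measure.restrict_congr_set Ioo_ae_eq_Ioc]
  rw [← ofReal_integral_eq_lintegral_ofReal, ← intervalIntegral.integral_of_le (by linarith)]
  · exact ENNReal.ofReal_le_ofReal hval
  · exact (intervalIntegrable_iff_integrableOn_Ioc_of_le (by linarith)).1 hint2
  · exact Eventually.of_forall fun θ => sub_nonneg.2 (hle θ)

/-- The integral of `log M - log |f|` over a disc. -/
theorem lintegral_ball_log_sub_log_norm_le {f : ℂ → ℂ} (hf : Differentiable ℂ f) {c : ℂ}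
    {r M : ℝ} (hr : 0 < r) (hM : ∀ z ∈ closedBall c r, ‖f z‖ ≤ M) (hM1 : 1 ≤ M)
    (hc : 1 / 2 ≤ ‖f c‖) :
    ∫⁻ z in ball c r, ENNReal.ofReal (Real.log M - Real.log ‖f z‖) ≤
      ENNReal.ofReal (r ^ 2 * (2 * Real.pi * (Real.log M + Real.log 2))) := by
  set ψ : ℂ → ENNReal := fun z => ENNReal.ofReal (Real.log M - Real.log ‖f z‖) with hψ
  set X := 2 * Real.pi * (Real.log M + Real.log 2) with hX
  have hψm : Measurable ψ := by
    have := hf.continuous.measurable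
    fun_prop
  have h1 : ∫⁻ z in ball c r, ψ z = ∫⁻ z, (ball (0 : ℂ) r).indicator (fun z => ψ (c + z)) z := by
    rw [← lintegral_indicator measurableSet_ball, ← lintegral_add_left_eq_self _ c]
    congr 1
    ext z
    by_cases hz : z ∈ ball (0 : ℂ) r
    · rw [indicator_of_mem hz, indicator_of_mem (by simpa using hz)]
    · rw [indicator_of_notMem hz, indicator_of_notMem (by simpa using hz)]
  rw [h1, ← Complex.lintegral_comp_polarCoord_symm]
  have hmeas : Measurable fun p : ℝ × ℝ => ENNReal.ofReal p.1 •
      (ball (0 : ℂ) r).indicator (fun z => ψ (c + z)) (Complex.polarCoord.symm p) := by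
    have hp : Measurable fun p : ℝ × ℝ => Complex.polarCoord.symm p := by
      simp only [Complex.polarCoord_symm_apply]
      fun_prop
    have h3 : Measurable ((ball (0 : ℂ) r).indicator fun z => ψ (c + z)) :=
      (hψm.comp (measurable_const_add c)).indicator measurableSet_ball
    exact (ENNReal.measurable_ofReal.comp measurable_fst).smul (h3.comp hp)
  rw [polarCoord_target, Measure.volume_eq_prod, ← Measure.prod_restrict,
    lintegral_prod _ hmeas.aemeasurable]
  -- In polar coordinates every circle of radius `ρ < r` obeys the same bound `X`, and the Jacobian
  -- is at most `r`; integrating over `(0, r)` gives `r² X`.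
  have h2 : ∀ ρ ∈ Ioi (0 : ℝ), ∫⁻ θ in Ioo (-Real.pi) Real.pi, ENNReal.ofReal ρ •
      (ball (0 : ℂ) r).indicator (fun z => ψ (c + z)) (Complex.polarCoord.symm (ρ, θ)) ≤
      (Ioo 0 r).indicator (fun _ => ENNReal.ofReal r * ENNReal.ofReal X) ρ := by
    intro ρ hρ
    have hρ0 : 0 < ρ := hρ
    by_cases hρr : ρ < r
    · rw [indicator_of_mem (show ρ ∈ Ioo 0 r from ⟨hρ, hρr⟩)]
      have h4 : ∀ θ : ℝ, ENNReal.ofReal ρ •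
          (ball (0 : ℂ) r).indicator (fun z => ψ (c + z)) (Complex.polarCoord.symm (ρ, θ)) =
          ENNReal.ofReal ρ * ψ (circleMap c ρ θ) := by
        intro θ
        rw [indicator_of_mem (by
          rw [mem_ball_zero_iff, Complex.norm_polarCoord_symm, abs_of_pos hρ0]; exact hρr),
          smul_eq_mul, Complex.polarCoord_symm_apply, circleMap, Complex.exp_mul_I, ofReal_cos, ofReal_sin]
      simp_rw [h4]
      rw [lintegral_const_mul' _ _ ENNReal.ofReal_ne_top]
      refine mul_le_mul' (ENNReal.ofReal_le_ofReal hρr.le) ?_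
      exact lintegral_circle_log_sub_log_norm_le hf hρ0
        (fun z hz => hM z (closedBall_subset_closedBall hρr.le hz)) hM1 hc
    · rw [indicator_of_notMem (fun h => hρr h.2)]
      have h4 : ∀ θ : ℝ, ENNReal.ofReal ρ •
          (ball (0 : ℂ) r).indicator (fun z => ψ (c + z)) (Complex.polarCoord.symm (ρ, θ)) = 0 := by
        intro θ
        rw [indicator_of_notMem (by
          rw [mem_ball_zero_iff, Complex.norm_polarCoord_symm, abs_of_pos hρ0]; exact hρr),
          smul_zero]
      rw [lintegral_congr h4, lintegral_zero]
  refine (setLIntegral_mono_ae' measurableSet_Ioi (Eventually.of_forall h2)).trans ?_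
  refine (setLIntegral_le_lintegral _ _).trans ?_
  rw [lintegral_indicator measurableSet_Ioo, setLIntegral_const, Real.volume_Ioo, sub_zero,
    mul_right_comm, ← ENNReal.ofReal_mul hr.le, mul_comm (ENNReal.ofReal _), mul_comm,
    ← ENNReal.ofReal_mul (by positivity), pow_two]

/-- Among the horizontal lines crossing a disc there is one on which the weighted logarithmic
integral is not too small. -/
theorem exists_line_weightedLogIntegral_ge {f : ℂ → ℂ} (hf : Differentiable ℂ f) {σ b T r M : ℝ}
    {c : ℂ} (hσb : σ ≤ b) (hr : 0 < r) (hM : ∀ z ∈ closedBall c r, ‖f z‖ ≤ M) (hM1 : 1 ≤ M)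
    (hc : 1 / 2 ≤ ‖f c‖) (hrect : Icc σ b ×ℂ Icc T (T + 1) ⊆ ball c r) :
    ∃ a ∈ Icc T (T + 1),
      -((b - σ) * (r ^ 2 * (2 * Real.pi * (Real.log M + Real.log 2)))) ≤
        weightedLogIntegral f σ b a := by
  set X := r ^ 2 * (2 * Real.pi * (Real.log M + Real.log 2)) with hX
  have hlogM : 0 ≤ Real.log M := Real.log_nonneg hM1
  have hX0 : 0 ≤ X := by positivity
  set ψ : ℂ → ENNReal := fun z => ENNReal.ofReal (Real.log M - Real.log ‖f z‖) with hψ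
  have hψm : Measurable ψ := by
    have := hf.continuous.measurable
    fun_prop
  set G : ℝ → ENNReal := fun a => ∫⁻ x in Icc σ b, ψ (x + a * I) with hG
  have hm2 : Measurable fun p : ℝ × ℝ => ψ (p.1 + p.2 * I) := by
    exact hψm.comp (Continuous.measurable (by fun_prop))
  have hGm : Measurable G := hm2.lintegral_prod_left'
  have htot : ∫⁻ a in Icc T (T + 1), G a ≤ ENNReal.ofReal X := by
    calc ∫⁻ a in Icc T (T + 1), G a
        = ∫⁻ p in Icc σ b ×ˢ Icc T (T + 1), ψ (p.1 + p.2 * I) := by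
          rw [Measure.volume_eq_prod, ← Measure.prod_restrict,
            lintegral_prod_symm _ hm2.aemeasurable]
      _ = ∫⁻ z in Icc σ b ×ℂ Icc T (T + 1), ψ z := by
          have hmp := Complex.volume_preserving_equiv_real_prod
          rw [← hmp.setLIntegral_comp_preimage_emb measurableEquivRealProd.measurableEmbedding]
          have hpre : measurableEquivRealProd ⁻¹' (Icc σ b ×ˢ Icc T (T + 1)) =
              Icc σ b ×ℂ Icc T (T + 1) := by
            ext z
            simp [mem_reProdIm, Complex.measurableEquivRealProd_apply, Prod.le_def]
            tauto
          rw [hpre]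
          congr 1
          ext z
          simp [Complex.measurableEquivRealProd_apply, re_add_im]
      _ ≤ ∫⁻ z in ball c r, ψ z := lintegral_mono_set hrect
      _ ≤ ENNReal.ofReal X := lintegral_ball_log_sub_log_norm_le hf hr hM hM1 hc
  -- The interval of heights has length `1`, so the mean equals the total and some height does not
  -- exceed it.
  obtain ⟨a, ha, hGa⟩ := exists_le_setLAverage (μ := volume) (s := Icc T (T + 1)) (f := G)
    (by simp) (by simp) hGm.aemeasurable
  rw [setLAverage_eq] at hGa
  have hvol : volume (Icc T (T + 1)) = 1 := by simp
  rw [hvol, div_one] at hGa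
  have hGX := hGa.trans htot
  refine ⟨a, ha, ?_⟩
  have hle : ∀ x ∈ Icc σ b, Real.log ‖f (x + a * I)‖ ≤ Real.log M := by
    intro x hx
    by_cases h : f (x + a * I) = 0
    · simpa [h] using hlogM
    · exact Real.log_le_log (norm_pos_iff.2 h) (hM _ (ball_subset_closedBall
        (hrect (mem_rect hx ha))))
  have hint : IntervalIntegrable (fun x : ℝ => Real.log M - Real.log ‖f (x + a * I)‖) volume σ b :=
    intervalIntegrable_const.sub (intervalIntegrable_log_norm_horizontal hf a σ b)
  have hψint : ∫ x in σ..b, (Real.log M - Real.log ‖f (x + a * I)‖) ≤ X := by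
    rw [intervalIntegral.integral_of_le hσb, ← integral_Icc_eq_integral_Ioc,
      ← ENNReal.ofReal_le_ofReal_iff hX0, ofReal_integral_eq_lintegral_ofReal]
    · exact hGX
    · exact (intervalIntegrable_iff_integrableOn_Icc_of_le hσb).1 hint
    · exact (ae_restrict_mem measurableSet_Icc).mono fun x hx => sub_nonneg.2 (hle x hx)
  calc -((b - σ) * X) ≤ -((b - σ) * ∫ x in σ..b, (Real.log M - Real.log ‖f (x + a * I)‖)) := by
        have : 0 ≤ b - σ := by linarith
        gcongr
    _ = ∫ x in σ..b, -((b - σ) * (Real.log M - Real.log ‖f (x + a * I)‖)) := by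
        rw [intervalIntegral.integral_neg, intervalIntegral.integral_const_mul]
    _ ≤ weightedLogIntegral f σ b a := by
        refine intervalIntegral.integral_mono_on hσb (hint.const_mul _).neg
          (intervalIntegrable_weighted_log_norm hf σ b a) fun x hx => ?_
        -- The inequality is pointwise: `0 ≤ x - σ ≤ b - σ` and `log M ≥ 0` give `(x - σ) log |f| ≥
        -- -(b - σ)(log M - log |f|)`.
        have h1 := hle x hx
        nlinarith [mul_nonneg (sub_nonneg.2 hx.2) (sub_nonneg.2 h1), mul_nonneg (sub_nonneg.2 hx.1) hlogM]

end

/-! ### The right edge, and logarithmic bounds for the auxiliary function. -/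

section

open Complex Set MeasureTheory Filter Topology

/-- The rectangle integral of the logarithm of a function that tends to `1` exponentially fast to the
right. -/
theorem abs_integral_log_norm_vertical_le {f : ℂ → ℂ} (hf : Differentiable ℂ f) {b t' t C k : ℝ}
    (hC : 0 ≤ C) (hk : 0 < k) (htt : t' ≤ t)
    (h1 : ∀ s : ℂ, b ≤ s.re → t' ≤ s.im → s.im ≤ t → ‖f s - 1‖ ≤ C * Real.exp (-(k * s.re)))
    (h2 : ∀ s : ℂ, b ≤ s.re → t' ≤ s.im → s.im ≤ t → ‖f s - 1‖ ≤ 1 / 2) :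
    |∫ τ in t'..t, Real.log ‖f (b + τ * I)‖| ≤ 3 * C * Real.exp (-(k * b)) / k := by
  have hslit : ∀ s : ℂ, b ≤ s.re → t' ≤ s.im → s.im ≤ t → f s ∈ slitPlane := by
    intro s hb ht' ht
    have := (abs_le.1 ((abs_re_le_norm _).trans (h2 s hb ht' ht))).1
    rw [sub_re, one_re] at this
    exact mem_slitPlane_iff.2 (Or.inl (by linarith))
  have hlog : ∀ s : ℂ, b ≤ s.re → t' ≤ s.im → s.im ≤ t →
      ‖Complex.log (f s)‖ ≤ 3 / 2 * C * Real.exp (-(k * s.re)) := by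
    intro s hb ht' ht
    have := norm_log_one_add_half_le_self (h2 s hb ht' ht)
    rw [add_sub_cancel] at this
    linarith [h1 s hb ht' ht]
  have hd : ∀ s : ℂ, b ≤ s.re → t' ≤ s.im → s.im ≤ t →
      DifferentiableAt ℂ (fun s => Complex.log (f s)) s :=
    fun s hb ht' ht => (hf s).clog (hslit s hb ht' ht)
  have hexp : ∀ B : ℝ, ∫ x in b..B, Real.exp (-(k * x)) ≤ Real.exp (-(k * b)) / k := by
    intro B
    rw [intervalIntegral.integral_eq_sub_of_hasDerivAt
      (f := fun x => -(Real.exp (-(k * x)) / k)) (fun x _ => ?_)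
      (Continuous.intervalIntegrable (by fun_prop) _ _)]
    · have : 0 ≤ Real.exp (-(k * B)) / k := by positivity
      linarith
    · have h3 : HasDerivAt (fun x => -(k * x)) (-(k * 1)) x := ((hasDerivAt_id x).const_mul k).neg
      rw [mul_one] at h3
      refine (h3.exp.div_const k).neg.congr_deriv ?_
      field_simp
  have hhor : ∀ B : ℝ, b ≤ B → ∀ y : ℝ, t' ≤ y → y ≤ t →
      ‖∫ x in b..B, Complex.log (f (x + y * I))‖ ≤ 3 / 2 * C * (Real.exp (-(k * b)) / k) := by
    intro B hB y hy' hy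
    calc _ ≤ ∫ x in b..B, 3 / 2 * C * Real.exp (-(k * x)) := by
          refine intervalIntegral.norm_integral_le_of_norm_le hB (Eventually.of_forall fun x hx => ?_)
            (Continuous.intervalIntegrable (by fun_prop) _ _)
          simpa using hlog (x + y * I) (by simpa using hx.1.le) (by simpa using hy')
            (by simpa using hy)
      _ ≤ _ := by
          rw [intervalIntegral.integral_const_mul]
          gcongr
          exact hexp B
  -- Cauchy's theorem for `log f` moves the vertical side to `re s = B`. As `B → ∞` that side
  -- vanishes, and the horizontal sides give a bound independent of `t - t'`.
  have hB : ∀ B : ℝ, b ≤ B → ‖∫ τ in t'..t, Complex.log (f (b + τ * I))‖ ≤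
      3 * C * Real.exp (-(k * b)) / k + 3 / 2 * C * Real.exp (-(k * B)) * |t - t'| := by
    intro B hB
    have key := integral_boundary_rect_eq_zero_of_differentiableOn (fun s => Complex.log (f s))
      ⟨b, t'⟩ ⟨B, t⟩ (fun s hs => by
        rw [mem_reProdIm, uIcc_of_le hB, uIcc_of_le htt] at hs
        exact (hd s hs.1.1 hs.2.1 hs.2.2).differentiableWithinAt)
    simp only at key
    have h3 : ‖∫ τ in t'..t, Complex.log (f (B + τ * I))‖ ≤
        3 / 2 * C * Real.exp (-(k * B)) * |t - t'| := by
      refine intervalIntegral.norm_integral_le_of_norm_le_const fun τ hτ => ?_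
      rw [uIoc_of_le htt] at hτ
      simpa using hlog (B + τ * I) (by simpa using hB) (by simpa using hτ.1.le)
        (by simpa using hτ.2)
    have h4 : I • (∫ τ in t'..t, Complex.log (f (b + τ * I))) =
        (∫ x in b..B, Complex.log (f (x + t' * I))) - (∫ x in b..B, Complex.log (f (x + t * I))) +
          I • ∫ τ in t'..t, Complex.log (f (B + τ * I)) := by
      linear_combination -key
    have h5 := congrArg norm h4
    rw [norm_smul, norm_I, one_mul] at h5
    rw [h5]
    refine (norm_add_le _ _).trans (add_le_add ((norm_sub_le _ _).trans ?_) ?_)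
    · refine (add_le_add (hhor B hB t' le_rfl htt) (hhor B hB t htt le_rfl)).trans (le_of_eq ?_)
      ring
    · rwa [norm_smul, norm_I, one_mul]
  have hlim : Tendsto (fun B : ℝ => 3 * C * Real.exp (-(k * b)) / k +
      3 / 2 * C * Real.exp (-(k * B)) * |t - t'|) atTop (𝓝 (3 * C * Real.exp (-(k * b)) / k)) := by
    have h3 : Tendsto (fun B : ℝ => Real.exp (-(k * B))) atTop (𝓝 0) :=
      Real.tendsto_exp_neg_atTop_nhds_zero.comp (tendsto_id.const_mul_atTop hk)
    simpa using ((h3.const_mul (3 / 2 * C)).mul_const |t - t'|).const_add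
      (3 * C * Real.exp (-(k * b)) / k)
  have hbound := ge_of_tendsto hlim ((eventually_ge_atTop b).mono hB)
  have hre : ∫ τ in t'..t, Real.log ‖f (b + τ * I)‖ = (∫ τ in t'..t, Complex.log (f (b + τ * I))).re := by
    have hi : IntervalIntegrable (fun τ : ℝ => Complex.log (f (b + τ * I))) volume t' t := by
      apply ContinuousOn.intervalIntegrable
      intro τ hτ
      rw [uIcc_of_le htt] at hτ
      have h3 := (hd (b + τ * I) (by simp) (by simpa using hτ.1) (by simpa using hτ.2)).continuousAt
      have h4 : ContinuousAt (fun τ : ℝ => (b : ℂ) + τ * I) τ := by fun_prop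
      exact (ContinuousAt.comp (f := fun τ : ℝ => (b : ℂ) + τ * I) h3 h4).continuousWithinAt
    have := Complex.reCLM.intervalIntegral_comp_comm hi
    simp only [Complex.reCLM_apply, log_re] at this
    exact this
  rw [hre]
  exact (abs_re_le_norm _).trans hbound

/-- Along the segment `f` stays in the slit plane, so the integrand has the primitive `arg f`,
bounded by `π` at each end. -/
theorem abs_integral_re_logDeriv_vertical_le {f : ℂ → ℂ} (hf : Differentiable ℂ f) {b t' t : ℝ}
    (htt : t' ≤ t) (h2 : ∀ τ ∈ Icc t' t, ‖f (b + τ * I) - 1‖ ≤ 1 / 2) :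
    |∫ τ in t'..t, (logDeriv f (b + τ * I)).re| ≤ 2 * Real.pi := by
  have hslit : ∀ τ ∈ Icc t' t, f (b + τ * I) ∈ slitPlane := by
    intro τ hτ
    have := (abs_le.1 ((abs_re_le_norm _).trans (h2 τ hτ))).1
    rw [sub_re, one_re] at this
    exact mem_slitPlane_iff.2 (Or.inl (by linarith))
  have hd : ∀ τ ∈ uIcc t' t, HasDerivAt (fun τ : ℝ => (Complex.log (f (b + τ * I))).im)
      (logDeriv f (b + τ * I)).re τ := by
    intro τ hτ
    rw [uIcc_of_le htt] at hτ
    have h3 := (hf (b + τ * I)).hasDerivAt.clog (hslit τ hτ)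
    have h4 := hasDerivAt_im_vertical (h := fun s => Complex.log (f s)) h3.differentiableAt
    rwa [h3.deriv] at h4
  rw [intervalIntegral.integral_eq_sub_of_hasDerivAt hd]
  · rw [log_im, log_im]
    have h3 := abs_arg_le_pi (f (b + t * I))
    have h4 := abs_arg_le_pi (f (b + t' * I))
    refine (abs_sub _ _).trans ?_
    linarith
  · apply ContinuousOn.intervalIntegrable
    rw [uIcc_of_le htt]
    exact continuousOn_re_logDeriv_vertical hf fun τ hτ => slitPlane_ne_zero (hslit τ hτ)

/-- A vertical line to the right of which the auxiliary function is close to `1`. -/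
theorem exists_right_line (σ : ℝ) :
    ∃ b D : ℝ, σ < b ∧ 0 ≤ D ∧ (∀ s : ℂ, b ≤ s.re → 7 ≤ s.im → ‖riemannAux s - 1‖ ≤ 1 / 2) ∧
      ∀ t' t : ℝ, 7 ≤ t' → t' ≤ t →
        |∫ τ in t'..t, Real.log ‖riemannAux (b + τ * I)‖| ≤ D ∧
        |∫ τ in t'..t, (logDeriv riemannAux (b + τ * I)).re| ≤ D := by
  obtain ⟨C, hC, hR⟩ := exists_norm_riemannAux_sub_one_le
  obtain ⟨b₀, hb₀⟩ := eventually_atTop.1 ((tendsto_const_mul_rpow_neg C).eventually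
    (gt_mem_nhds (show (0 : ℝ) < 1 / 2 by norm_num)))
  set k := Real.log (21 / 20) with hk
  have hk0 : 0 < k := Real.log_pos (by norm_num)
  have hexp : ∀ x : ℝ, (21 / 20 : ℝ) ^ (-x) = Real.exp (-(k * x)) := fun x => by
    rw [Real.rpow_def_of_pos (by norm_num), ← hk, mul_neg]
  set b := max (max b₀ 2) (σ + 1) with hb
  have hb1 : b₀ ≤ b := (le_max_left _ _).trans (le_max_left _ _)
  have hb2 : 2 ≤ b := (le_max_right _ _).trans (le_max_left _ _)
  have hb3 : σ < b := (lt_add_one σ).trans_le (le_max_right _ _)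
  have hhalf : ∀ s : ℂ, b ≤ s.re → 7 ≤ s.im → ‖riemannAux s - 1‖ ≤ 1 / 2 := fun s hs ht =>
    (hR s (hb2.trans hs) ht).trans (hb₀ s.re (hb1.trans hs)).le
  refine ⟨b, max (3 * C * Real.exp (-(k * b)) / k) (2 * Real.pi), hb3,
    (by positivity : (0 : ℝ) ≤ 2 * Real.pi).trans (le_max_right _ _), hhalf, fun t' t ht' htt => ⟨?_, ?_⟩⟩
  · refine (abs_integral_log_norm_vertical_le differentiable_riemannAux hC hk0 htt
      (fun s hs h1 _ => ?_) (fun s hs h1 _ => hhalf s hs (ht'.trans h1))).trans (le_max_left _ _)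
    rw [← hexp]
    exact hR s (hb2.trans hs) (ht'.trans h1)
  · refine (abs_integral_re_logDeriv_vertical_le differentiable_riemannAux htt fun τ hτ =>
      hhalf _ (by simp) ?_).trans (le_max_right _ _)
    simpa using ht'.trans hτ.1

theorem log_norm_riemannAux_le_of_norm_le {M : ℝ} (hM : 1 ≤ M) {s : ℂ} (h : ‖riemannAux s‖ ≤ M) :
    Real.log ‖riemannAux s‖ ≤ Real.log M := by
  by_cases h0 : riemannAux s = 0
  · simpa [h0] using Real.log_nonneg hM
  · exact Real.log_le_log (norm_pos_iff.2 h0) h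

/-- Logarithmic upper bound for `log |𝓡|` on a vertical line, and good horizontal lines. -/
theorem exists_log_bounds {σ b : ℝ} (hσb : σ < b)
    (hb : ∀ s : ℂ, b ≤ s.re → 7 ≤ s.im → ‖riemannAux s - 1‖ ≤ 1 / 2) :
    ∃ A T₁ : ℝ, 0 ≤ A ∧ 7 ≤ T₁ ∧
      (∀ t : ℝ, T₁ ≤ t → Real.log ‖riemannAux (σ + t * I)‖ ≤ A * Real.log t) ∧
      ∀ T : ℝ, T₁ ≤ T → ∃ a ∈ Icc T (T + 1),
        |weightedLogIntegral riemannAux σ b a| ≤ A * Real.log T := by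
  obtain ⟨k, hk⟩ := exists_nat_ge (1 - σ)
  obtain ⟨C, hC1, hR⟩ := exists_norm_riemannAux_le k
  -- The disc is centred on `re s = b`, so it reaches exactly to `σ - 1`; this is why `k ≥ 1 - σ`.
  set r := b - σ + 1 with hr
  have hr0 : 0 < r := by linarith
  set B := Real.log C + 2 * ((k : ℝ) + 1) with hB
  have hlogC : 0 ≤ Real.log C := Real.log_nonneg hC1
  have hB0 : 0 ≤ B := by positivity
  set Q := 1 + (b - σ) * (b - σ) + (b - σ) * (r ^ 2 * (2 * Real.pi * 2)) with hQ
  have hbσ : 0 ≤ b - σ := by linarith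
  have hQ1 : 1 ≤ Q := by
    have : 0 ≤ (b - σ) * (b - σ) + (b - σ) * (r ^ 2 * (2 * Real.pi * 2)) := by positivity
    linarith
  have hlogT : ∀ T : ℝ, 7 ≤ T → 1 ≤ Real.log T := by
    intro T hT
    rw [Real.le_log_iff_exp_le (by linarith)]
    linarith [Real.exp_one_lt_d9]
  have hMlog : ∀ T : ℝ, 7 ≤ T → Real.log (C * (2 * T) ^ (k + 1)) ≤ B * Real.log T := by
    intro T hT
    have h1 := hlogT T hT
    rw [Real.log_mul (by positivity) (by positivity), Real.log_pow,
      Real.log_mul (by norm_num) (by positivity)]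
    have h2 : Real.log 2 ≤ Real.log T := Real.log_le_log (by norm_num) (by linarith)
    push_cast
    have h3 : Real.log C ≤ Real.log C * Real.log T := le_mul_of_one_le_right hlogC h1
    have h4 : ((k : ℝ) + 1) * (Real.log 2 + Real.log T) ≤ ((k : ℝ) + 1) * (2 * Real.log T) := by
      gcongr; linarith
    rw [hB]; linarith
  have hupper : ∀ T : ℝ, 7 ≤ T → ∀ s : ℂ, σ - 1 ≤ s.re → 7 ≤ s.im → s.im ≤ 2 * T →
      ‖riemannAux s‖ ≤ C * (2 * T) ^ (k + 1) := by
    intro T hT s hs h7 h2T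
    refine (hR s (by linarith) h7).trans ?_
    gcongr
  have hM1 : ∀ T : ℝ, 7 ≤ T → 1 ≤ C * (2 * T) ^ (k + 1) := fun T hT =>
    one_le_mul_of_one_le_of_one_le hC1 (one_le_pow₀ (by linarith))
  -- `T ≥ 8 + r` keeps the disc about height `T + 1/2` between the heights `7` and `2T`.
  refine ⟨(B + 1) * Q, 8 + r, by positivity, by linarith, fun t ht => ?_, fun T hT => ?_⟩
  · have ht7 : 7 ≤ t := by linarith
    have h1 := log_norm_riemannAux_le_of_norm_le (hM1 t ht7)
      (hupper t ht7 (σ + t * I) (by simp) (by simpa using ht7) (by simp; linarith))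
    have h2 := hlogT t ht7
    calc _ ≤ B * Real.log t := h1.trans (hMlog t ht7)
      _ ≤ (B + 1) * Q * Real.log t := by
        gcongr
        nlinarith
  · have hT7 : 7 ≤ T := by linarith
    set M := C * (2 * T) ^ (k + 1) with hM
    have hlT := hlogT T hT7
    have hlM0 : 0 ≤ Real.log M := Real.log_nonneg (hM1 T hT7)
    set c : ℂ := ⟨b, T + 1 / 2⟩ with hc
    have hball : ∀ z ∈ Metric.closedBall c r, ‖riemannAux z‖ ≤ M := by
      intro z hz
      rw [mem_closedBall_iff_norm] at hz
      have h1 := abs_le.1 ((abs_re_le_norm _).trans hz)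
      have h2 := abs_le.1 ((abs_im_le_norm _).trans hz)
      simp only [sub_re, sub_im, hc] at h1 h2
      exact hupper T hT7 z (by linarith [h1.1]) (by linarith [h2.1]) (by linarith [h2.2])
    have hcen : 1 / 2 ≤ ‖riemannAux c‖ := by
      have h1 := hb c le_rfl (by simp [hc]; linarith)
      have h2 := norm_sub_norm_le (1 : ℂ) (1 - riemannAux c)
      rw [norm_one, sub_sub_cancel, norm_sub_rev] at h2
      linarith
    have hrect : Icc σ b ×ℂ Icc T (T + 1) ⊆ Metric.ball c r := by
      intro z hz
      rw [mem_reProdIm] at hz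
      rw [mem_ball_iff_norm]
      refine (norm_le_abs_re_add_abs_im _).trans_lt ?_
      have h1 : |(z - c).re| ≤ b - σ := by
        rw [sub_re, abs_le]
        constructor <;> simp only [hc] <;> linarith [hz.1.1, hz.1.2]
      have h2 : |(z - c).im| ≤ 1 / 2 := by
        rw [sub_im, abs_le]
        constructor <;> simp only [hc] <;> linarith [hz.2.1, hz.2.2]
      linarith
    obtain ⟨a, ha, hla⟩ := exists_line_weightedLogIntegral_ge differentiable_riemannAux hσb.le hr0
      hball (hM1 T hT7) hcen hrect
    refine ⟨a, ha, abs_le.2 ⟨?_, ?_⟩⟩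
    · refine le_trans ?_ hla
      rw [neg_le_neg_iff]
      have h1 : Real.log M + Real.log 2 ≤ (B + 1) * 2 * Real.log T := by
        have h2 : Real.log 2 ≤ Real.log T := Real.log_le_log (by norm_num) (by linarith)
        nlinarith [hMlog T hT7]
      calc _ ≤ (b - σ) * (r ^ 2 * (2 * Real.pi * ((B + 1) * 2 * Real.log T))) := by gcongr
        _ = (B + 1) * ((b - σ) * (r ^ 2 * (2 * Real.pi * 2))) * Real.log T := by ring
        _ ≤ (B + 1) * Q * Real.log T := by
          gcongr
          rw [hQ]
          nlinarith [mul_nonneg hbσ hbσ]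
    · have h1 : weightedLogIntegral riemannAux σ b a ≤ ∫ x in σ..b, (b - σ) * Real.log M := by
        refine intervalIntegral.integral_mono_on hσb.le
          (intervalIntegrable_weighted_log_norm differentiable_riemannAux σ b a)
          intervalIntegrable_const fun x hx => ?_
        have h2 := log_norm_riemannAux_le_of_norm_le (hM1 T hT7) (hball _
          (Metric.ball_subset_closedBall (hrect (mem_rect hx ha))))
        calc _ ≤ (x - σ) * Real.log M := by
              have := sub_nonneg.2 hx.1
              gcongr
          _ ≤ _ := by gcongr; exact hx.2
      rw [intervalIntegral.integral_const, smul_eq_mul] at h1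
      calc _ ≤ (b - σ) * ((b - σ) * Real.log M) := h1
        _ ≤ (b - σ) * ((b - σ) * (B * Real.log T)) := by gcongr; exact hMlog T hT7
        _ = B * ((b - σ) * (b - σ)) * Real.log T := by ring
        _ ≤ (B + 1) * Q * Real.log T := by
          gcongr
          · linarith
          · rw [hQ]
            have : 0 ≤ (b - σ) * (r ^ 2 * (2 * Real.pi * 2)) := by positivity
            linarith

end

/-! ### The zero sum, and the bound for the error. -/

section

open Complex Set MeasureTheory Filter Topology

theorem exists_riemannAux_ne_zero : ∃ s : ℂ, riemannAux s ≠ 0 := by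
  obtain ⟨b, hb⟩ := exists_riemannAux_ne_zero_of_im_mem 0
  exact ⟨b, hb b (by simp) (by simp) (by simp)⟩

theorem finite_riemannAuxZeros (σ T : ℝ) : (riemannAuxZeros σ T).Finite := by
  obtain ⟨s₀, hs₀⟩ := exists_riemannAux_ne_zero
  obtain ⟨b, hb⟩ := exists_riemannAux_ne_zero_of_im_mem T
  refine (finite_zeros_of_isCompact differentiable_riemannAux hs₀
    (isCompact_Icc.reProdIm isCompact_Icc : IsCompact (Icc σ b ×ℂ Icc 0 T))).subset ?_
  rintro ρ ⟨h0, h1, h2, h3⟩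
  refine ⟨h0, ?_⟩
  rw [mem_reProdIm]
  refine ⟨⟨h1.le, le_of_not_gt fun h => hb ρ h.le h2.le h3 h0⟩, h2.le, h3⟩

theorem riemannAuxZeroSum_sub {σ t' t : ℝ} (htt : t' ≤ t) :
    riemannAuxZeroSum σ t - riemannAuxZeroSum σ t' =
      ∑ᶠ ρ ∈ riemannAuxZeros σ t \ riemannAuxZeros σ t',
        (analyticOrderNatAt riemannAux ρ : ℝ) * (ρ.re - σ) := by
  have hsub : riemannAuxZeros σ t' ⊆ riemannAuxZeros σ t :=
    fun ρ hρ => ⟨hρ.1, hρ.2.1, hρ.2.2.1, hρ.2.2.2.trans htt⟩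
  have hfin := finite_riemannAuxZeros σ t
  rw [riemannAuxZeroSum, riemannAuxZeroSum, ← finsum_mem_add_sdiff hsub hfin]
  ring

theorem riemannAuxZeroSum_mono {σ t' t : ℝ} (htt : t' ≤ t) :
    riemannAuxZeroSum σ t' ≤ riemannAuxZeroSum σ t := by
  rw [← sub_nonneg, riemannAuxZeroSum_sub htt]
  exact finsum_nonneg fun ρ => finsum_nonneg fun hρ => mul_nonneg (Nat.cast_nonneg _) (sub_nonneg.2 hρ.1.2.1.le)

/-- The closed rectangle also catches zeros with `β = σ`, but their weight is `0`, so the two sums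
agree on supports; zeros with `β ≥ b` do not exist at these heights. -/
theorem riemannAuxZeroSum_sub_eq_sum {σ b T t' t : ℝ} {Z : Finset ℂ}
    (hZ : ∀ ρ, ρ ∈ Z ↔ riemannAux ρ = 0 ∧ ρ ∈ Icc σ b ×ℂ Icc 7 T)
    (hb : ∀ s : ℂ, b ≤ s.re → 7 ≤ s.im → riemannAux s ≠ 0)
    (h7 : 7 ≤ t') (htt : t' ≤ t) (htT : t ≤ T) :
    riemannAuxZeroSum σ t - riemannAuxZeroSum σ t' =
      ∑ ρ ∈ Z with t' < ρ.im ∧ ρ.im ≤ t, (analyticOrderNatAt riemannAux ρ : ℝ) * (ρ.re - σ) := by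
  rw [riemannAuxZeroSum_sub htt]
  apply finsum_mem_eq_sum_of_inter_support_eq
  ext ρ
  simp only [mem_inter_iff, Set.mem_sdiff, Finset.mem_coe, Finset.mem_filter, hZ, mem_reProdIm,
    Function.mem_support]
  refine and_congr_left fun hne => ?_
  have hreσ : ρ.re ≠ σ := fun h => hne (by simp [h])
  constructor
  · rintro ⟨⟨h1, h2, h3, h4⟩, h5⟩
    have h6 : t' < ρ.im := by
      by_contra h
      exact h5 ⟨h1, h2, h3, not_lt.1 h⟩
    exact ⟨⟨h1, ⟨h2.le, le_of_not_gt fun h => hb ρ h.le (h7.trans h6.le) h1⟩, h7.trans h6.le,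
      h4.trans htT⟩, h6, h4⟩
  · rintro ⟨⟨h1, ⟨h2, -⟩, -⟩, h3, h4⟩
    exact ⟨⟨h1, lt_of_le_of_ne h2 hreσ.symm, by linarith, h4⟩, fun h => absurd h.2.2.2 (not_le.2 h3)⟩

/-- The difference of the two sides of the asymptotic formula over a segment. -/
noncomputable def zeroSumError (σ t' t : ℝ) : ℝ :=
  (∫ τ in t'..t, Real.log ‖riemannAux (σ + τ * I)‖) -
    2 * Real.pi * (riemannAuxZeroSum σ t - riemannAuxZeroSum σ t')

/-- Only an upper bound is claimed: the zero sum enters with a negative sign and is nondecreasing,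
so it can be dropped. -/
theorem zeroSumError_le {σ A T₁ t' t T : ℝ} (hA : 0 ≤ A) (h7 : 7 ≤ T₁)
    (hlog : ∀ t : ℝ, T₁ ≤ t → Real.log ‖riemannAux (σ + t * I)‖ ≤ A * Real.log t)
    (ht' : T₁ ≤ t') (htt : t' ≤ t) (htT : t ≤ T) :
    zeroSumError σ t' t ≤ A * Real.log T * (t - t') := by
  have h1 : ∫ τ in t'..t, Real.log ‖riemannAux (σ + τ * I)‖ ≤ ∫ τ in t'..t, A * Real.log T := by
    refine intervalIntegral.integral_mono_on htt
      (intervalIntegrable_log_norm_vertical differentiable_riemannAux σ t' t)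
      intervalIntegrable_const fun τ hτ => (hlog τ (ht'.trans hτ.1)).trans ?_
    have : 0 < τ := by linarith [hτ.1]
    gcongr
    exact hτ.2.trans htT
  rw [intervalIntegral.integral_const, smul_eq_mul] at h1
  have h2 := mul_nonneg Real.two_pi_pos.le
    (sub_nonneg.2 (riemannAuxZeroSum_mono (σ := σ) htt))
  rw [zeroSumError]
  linarith

theorem zeroSumError_add (σ t₀ t' t : ℝ) :
    zeroSumError σ t₀ t' + zeroSumError σ t' t = zeroSumError σ t₀ t := by
  have h := intervalIntegrable_log_norm_vertical differentiable_riemannAux σ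
  rw [zeroSumError, zeroSumError, zeroSumError,
    ← intervalIntegral.integral_add_adjacent_intervals (h t₀ t') (h t' t)]
  ring

/-- Littlewood's lemma with the two integrals along `re s = b` absorbed into a constant. The
constant does not depend on `T`, although `κ` may. -/
theorem exists_deriv_weightedLogIntegral_riemannAux {σ b D : ℝ} (hσb : σ < b)
    (hb : ∀ s : ℂ, b ≤ s.re → 7 ≤ s.im → riemannAux s ≠ 0)
    (hD : ∀ t' t : ℝ, 7 ≤ t' → t' ≤ t →
        |∫ τ in t'..t, Real.log ‖riemannAux (b + τ * I)‖| ≤ D ∧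
        |∫ τ in t'..t, (logDeriv riemannAux (b + τ * I)).re| ≤ D) {T : ℝ} (hT : 7 ≤ T) :
    ∃ κ : ℝ → ℝ, IntervalIntegrable κ volume 7 T ∧
      (∀ t' ∈ Icc 7 T, ∀ t ∈ Icc 7 T, weightedLogIntegral riemannAux σ b t -
        weightedLogIntegral riemannAux σ b t' = ∫ τ in t'..t, κ τ) ∧
      ∀ t' ∈ Icc 7 T, ∀ t ∈ Icc 7 T, t' ≤ t →
        |κ t - κ t' + zeroSumError σ t' t| ≤ D + (b - σ) * D := by
  have hbline : ∀ t ∈ Icc 7 T, riemannAux (b + t * I) ≠ 0 := fun t ht =>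
    hb _ (by simp) (by simpa using ht.1)
  obtain ⟨κ, Z, hκi, hZ, hU, hκ⟩ := exists_deriv_weightedLogIntegral differentiable_riemannAux hσb hT
    hbline
  refine ⟨κ, hκi, hU, fun t' ht' t ht htt => ?_⟩
  have hi := fun x => intervalIntegrable_log_norm_vertical differentiable_riemannAux x t' t
  have hl : IntervalIntegrable (fun τ : ℝ => (logDeriv riemannAux (b + τ * I)).re) volume t' t :=
    ((continuousOn_re_logDeriv_vertical differentiable_riemannAux hbline).mono
      (uIcc_subset_Icc ht' ht)).intervalIntegrable
  have e : ∫ τ in t'..t, littlewoodIntegrand riemannAux σ b τ =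
      (∫ τ in t'..t, Real.log ‖riemannAux (b + τ * I)‖) -
        (∫ τ in t'..t, Real.log ‖riemannAux (σ + τ * I)‖) -
        (b - σ) * ∫ τ in t'..t, (logDeriv riemannAux (b + τ * I)).re := by
    unfold littlewoodIntegrand
    rw [intervalIntegral.integral_sub ((hi b).sub (hi σ)) (hl.const_mul _),
      intervalIntegral.integral_sub (hi b) (hi σ), intervalIntegral.integral_const_mul]
  have hk := hκ t' ht' t ht htt
  rw [← riemannAuxZeroSum_sub_eq_sum hZ hb ht'.1 htt ht.2, e] at hk
  obtain ⟨h1, h2⟩ := hD t' t ht'.1 htt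
  have h3 : κ t - κ t' + zeroSumError σ t' t =
      (∫ τ in t'..t, Real.log ‖riemannAux (b + τ * I)‖) -
        (b - σ) * ∫ τ in t'..t, (logDeriv riemannAux (b + τ * I)).re := by
    rw [hk, zeroSumError]; ring
  rw [h3]
  refine (abs_sub _ _).trans (add_le_add h1 ?_)
  rw [abs_mul, abs_of_pos (sub_pos.2 hσb)]
  exact mul_le_mul_of_nonneg_left h2 (sub_pos.2 hσb).le

/-- A function whose integral between two points is small is bounded by its oscillation. -/
theorem abs_le_of_one_sided_bounds {κ U : ℝ → ℝ} {x X Y : ℝ} (hY : 0 ≤ Y)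
    {a c a' c' : ℝ} (hac : a + 1 ≤ c) (hac' : a' + 1 ≤ c')
    (hi : IntervalIntegrable κ volume a c) (hi' : IntervalIntegrable κ volume a' c')
    (hU : U c - U a = ∫ τ in a..c, κ τ) (hU' : U c' - U a' = ∫ τ in a'..c', κ τ)
    (hκ : ∀ τ ∈ Icc a c, x - X ≤ κ τ) (hκ' : ∀ τ ∈ Icc a' c', κ τ ≤ x + X)
    (ha : |U a| ≤ Y) (hc : |U c| ≤ Y) (ha' : |U a'| ≤ Y) (hc' : |U c'| ≤ Y) :
    |x| ≤ X + 2 * Y := by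
  rw [abs_le] at *
  -- If `x > X + 2Y`, then `κ > 2Y` on an interval of length at least `1`, so `U` rises by more than
  -- `2Y` between points where `|U| ≤ Y`. The primed interval excludes `x < -(X + 2Y)` likewise.
  have h1 : ∫ _ in a..c, (x - X) ≤ ∫ τ in a..c, κ τ :=
    intervalIntegral.integral_mono_on (by linarith) intervalIntegrable_const hi hκ
  have h2 : ∫ τ in a'..c', κ τ ≤ ∫ _ in a'..c', (x + X) :=
    intervalIntegral.integral_mono_on (by linarith) hi' intervalIntegrable_const hκ'
  rw [intervalIntegral.integral_const, smul_eq_mul] at h1 h2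
  constructor
  · by_contra! h
    nlinarith [ha'.1, ha'.2, hc'.1, hc'.2]
  · by_contra! h
    nlinarith [ha.1, ha.2, hc.1, hc.2]

/-- Up to `O(1)` the error is `κ(T₂) - κ(T)`. By `zeroSumError_le`, `κ` is increasing up to `O(log
T)` on bounded ranges, so its values after `T` bound `κ(T)` from above and those before `T` bound it
from below, through the good heights of `U`. -/
theorem exists_abs_zeroSumError_le (σ : ℝ) :
    ∃ C T₂ : ℝ, 7 ≤ T₂ ∧ ∀ T : ℝ, T₂ ≤ T → |zeroSumError σ T₂ T| ≤ C * Real.log T := by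
  obtain ⟨b, D, hσb, hD0, hhalf, hD⟩ := exists_right_line σ
  have hb : ∀ s : ℂ, b ≤ s.re → 7 ≤ s.im → riemannAux s ≠ 0 := by
    intro s hs h7 h0
    have := hhalf s hs h7
    rw [h0, zero_sub, norm_neg, norm_one] at this
    norm_num at this
  obtain ⟨A, T₁, hA, hT₁, hlog, hline⟩ := exists_log_bounds hσb hhalf
  set D' := D + (b - σ) * D with hD'
  have hD'0 : 0 ≤ D' := add_nonneg hD0 (mul_nonneg (sub_pos.2 hσb).le hD0)
  have hlogle : ∀ T : ℝ, 7 ≤ T → 1 ≤ Real.log T ∧ Real.log (T + 3) ≤ 2 * Real.log T := by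
    intro T hT
    constructor
    · rw [Real.le_log_iff_exp_le (by linarith)]
      linarith [Real.exp_one_lt_d9]
    · have h1 : Real.log (T ^ 2) = 2 * Real.log T := by rw [Real.log_pow]; norm_num
      rw [← h1]
      exact Real.log_le_log (by linarith) (by nlinarith)
  -- The argument below gives `5AL + D'` with `L = log (T + 3) ≤ 2 log T`: `3AL` from the drift over
  -- length `3`, and `2AL` from the two values of `U`.
  set C₁ := 10 * A + D' with hC₁
  have hkey : ∀ (Tm : ℝ) (κ : ℝ → ℝ), 7 ≤ Tm → IntervalIntegrable κ volume 7 Tm →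
      (∀ t' ∈ Icc 7 Tm, ∀ t ∈ Icc 7 Tm, weightedLogIntegral riemannAux σ b t -
        weightedLogIntegral riemannAux σ b t' = ∫ τ in t'..t, κ τ) →
      (∀ t' ∈ Icc 7 Tm, ∀ t ∈ Icc 7 Tm, t' ≤ t → |κ t - κ t' + zeroSumError σ t' t| ≤ D') →
      ∀ T : ℝ, T₁ + 3 ≤ T → T + 3 ≤ Tm → |κ T| ≤ C₁ * Real.log T := by
    intro Tm κ hTm hκi hU hκ T hT hTTm
    obtain ⟨hl1, hl2⟩ := hlogle T (by linarith)
    set L := Real.log (T + 3) with hL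
    have hL0 : 0 ≤ L := Real.log_nonneg (by linarith)
    -- Good heights are taken in `[T, T+1]` and `[T+2, T+3]`, and in `[T-3, T-2]` and `[T-1, T]`, so
    -- each pair is at least `1` apart and lies on one side of `T`.
    obtain ⟨a, ha, hUa⟩ := hline T (by linarith)
    obtain ⟨c, hc, hUc⟩ := hline (T + 2) (by linarith)
    obtain ⟨a', ha', hUa'⟩ := hline (T - 3) (by linarith)
    obtain ⟨c', hc', hUc'⟩ := hline (T - 1) (by linarith)
    have hmono : ∀ t : ℝ, 0 < t → t ≤ T + 3 → A * Real.log t ≤ A * L := fun t ht htT =>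
      mul_le_mul_of_nonneg_left (Real.log_le_log ht htT) hA
    have hTmem : T ∈ Icc 7 Tm := ⟨by linarith, by linarith⟩
    have hbound : |κ T| ≤ (3 * (A * L) + D') + 2 * (A * L) := by
      refine abs_le_of_one_sided_bounds (κ := κ) (U := weightedLogIntegral riemannAux σ b)
        (a := a) (c := c) (a' := a') (c' := c') (by positivity)
        (by linarith [ha.2, hc.1]) (by linarith [ha'.2, hc'.1]) (hκi.mono_set ?_) (hκi.mono_set ?_)
        (hU a ?_ c ?_) (hU a' ?_ c' ?_) ?_ ?_
        (hUa.trans (hmono _ (by linarith) (by linarith)))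
        (hUc.trans (hmono _ (by linarith) (by linarith)))
        (hUa'.trans (hmono _ (by linarith) (by linarith)))
        (hUc'.trans (hmono _ (by linarith) (by linarith)))
      · rw [uIcc_of_le (by linarith [ha.2, hc.1]), uIcc_of_le hTm]
        exact Icc_subset_Icc (by linarith [ha.1]) (by linarith [hc.2])
      · rw [uIcc_of_le (by linarith [ha'.2, hc'.1]), uIcc_of_le hTm]
        exact Icc_subset_Icc (by linarith [ha'.1]) (by linarith [hc'.2])
      · exact ⟨by linarith [ha.1], by linarith [ha.2]⟩
      · exact ⟨by linarith [hc.1], by linarith [hc.2]⟩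
      · exact ⟨by linarith [ha'.1], by linarith [ha'.2]⟩
      · exact ⟨by linarith [hc'.1], by linarith [hc'.2]⟩
      · intro τ hτ
        have h1 : T ≤ τ := ha.1.trans hτ.1
        have h2 : τ ≤ T + 3 := by linarith [hτ.2, hc.2]
        have h3 := (abs_le.1 (hκ T hTmem τ ⟨by linarith, by linarith⟩ h1)).1
        have h4 := zeroSumError_le hA hT₁ hlog (by linarith) h1 h2
        have h5 : A * L * (τ - T) ≤ A * L * 3 := by gcongr; linarith
        linarith
      · intro τ hτ
        have h1 : τ ≤ T := by linarith [hτ.2, hc'.2]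
        have h2 : T - 3 ≤ τ := ha'.1.trans hτ.1
        have h3 := (abs_le.1 (hκ τ ⟨by linarith, by linarith⟩ T hTmem h1)).1
        have h4 := zeroSumError_le hA hT₁ hlog (by linarith) h1 (by linarith : T ≤ T + 3)
        have h5 : A * L * (T - τ) ≤ A * L * 3 := by gcongr; linarith
        linarith
    have h6 : A * L ≤ A * (2 * Real.log T) := by gcongr
    have h7 : D' ≤ D' * Real.log T := le_mul_of_one_le_right hD'0 hl1
    rw [hC₁]; linarith
  refine ⟨2 * C₁ + D', T₁ + 3, by linarith, fun T hT => ?_⟩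
  -- A new `κ` is produced for each `T`, so its value at the fixed point `T₁ + 3` must also be
  -- estimated by `hkey`, whose constant is the same for all of them.
  obtain ⟨κ, hκi, hU, hκ⟩ := exists_deriv_weightedLogIntegral_riemannAux hσb hb hD
    (T := T + 3) (by linarith)
  have h1 := hkey (T + 3) κ (by linarith) hκi hU hκ T hT le_rfl
  have h2 := hkey (T + 3) κ (by linarith) hκi hU hκ (T₁ + 3) le_rfl (by linarith)
  have h3 := hκ (T₁ + 3) ⟨by linarith, by linarith⟩ T ⟨by linarith, by linarith⟩ hT
  obtain ⟨hl1, -⟩ := hlogle T (by linarith)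
  have hC₁0 : 0 ≤ C₁ := by positivity
  have h4 : C₁ * Real.log (T₁ + 3) ≤ C₁ * Real.log T := by gcongr
  have h5 : D' ≤ D' * Real.log T := le_mul_of_one_le_right hD'0 hl1
  rw [abs_le] at *
  constructor <;> linarith [h1.1, h1.2, h2.1, h2.2, h3.1, h3.2]

end

theorem theorem1 (σ : ℝ) (hσ : σ ≤ 1) :
    (∀ T : ℝ, (riemannAuxZeros σ T).Finite) ∧
    (∀ t₀ T : ℝ, 1 ≤ t₀ → t₀ ≤ T →
      IntervalIntegrable (fun t : ℝ => Real.log ‖riemannAux ((σ : ℂ) + (t : ℂ) * Complex.I)‖)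
        MeasureTheory.volume t₀ T) ∧
    ∃ C : ℝ, ∀ t₀ : ℝ, 1 ≤ t₀ → ∃ T₀ : ℝ, ∀ T : ℝ, T₀ ≤ T →
      |(∫ t in t₀..T, Real.log ‖riemannAux ((σ : ℂ) + (t : ℂ) * Complex.I)‖) -
          2 * Real.pi * riemannAuxZeroSum σ T| ≤ C * Real.log T := by
  refine ⟨finite_riemannAuxZeros σ, fun t₀ T _ _ =>
    intervalIntegrable_log_norm_vertical differentiable_riemannAux σ t₀ T, ?_⟩
  obtain ⟨C, T₂, hT₂, hC⟩ := exists_abs_zeroSumError_le σ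
  -- All dependence on `t₀` sits in the constant `K`, which `log T` dominates once `T ≥ e^{|K|}`;
  -- the added `1` pays for it, so the constant depends on `σ` only.
  refine ⟨C + 1, fun t₀ _ => ?_⟩
  set K := zeroSumError σ t₀ T₂ - 2 * Real.pi * riemannAuxZeroSum σ t₀ with hK
  refine ⟨max T₂ (Real.exp |K|), fun T hT => ?_⟩
  have hT1 : T₂ ≤ T := (le_max_left _ _).trans hT
  have hKT : |K| ≤ Real.log T :=
    (Real.le_log_iff_exp_le (by linarith)).2 ((le_max_right _ _).trans hT)
  have e : (∫ t in t₀..T, Real.log ‖riemannAux ((σ : ℂ) + (t : ℂ) * Complex.I)‖) -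
      2 * Real.pi * riemannAuxZeroSum σ T = K + zeroSumError σ T₂ T := by
    rw [hK, sub_add_eq_add_sub, zeroSumError_add, zeroSumError]
    ring
  rw [e]
  refine (abs_add_le _ _).trans ?_
  linarith [hC T hT1]
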